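/- Let $(E,\|\cdot\|)$ be a separable Banach space. Let $\mathcal P_2(E)$ be the set of Borel probability measures $\mu$ on $E$ with $\int\|x\|^2\,d\mu(x)<\infty$, equipped with the Wasserstein distance $$W_2[\mu,\nu]=\Big(\inf_{\pi}\int_{E\times E}\|x-y\|^2\,d\pi(x,y)\Big)^{1/2},$$ where $\pi$ ranges over the probability measures on $E\times E$ with marginals $\mu$ and $\nu$, and with its Borel $\sigma$-algebra. For a random measure $\mu$, that is, a random variable $\mu:\Omega\to\mathcal P_2(E)$ on a probability space $(\Omega,\mathcal F,\mathbb P)$, the intensity $I(\mu)$ is the probability measure on $E$ defined by $\int f\,dI(\mu)=\mathbb E\big[\int f\,d\mu\big]$ for all bounded measurable $f:E\to\mathbb R$. **Proposition.** Let $\mu^N:\Omega\to\mathcal P_2(E)$, $N\ge1$, be a sequence of random measures on $E$ whose intensities $I(\mu^N)$ belong to $\mathcal P_2(E)$, i.e. $\mathbb E\big[\int\|x\|^2\,d\mu^N(x)\big]<\infty$ for every $N$. The following statements are equivalent: (i) the set $\{I(\mu^N): N\ge1\}$ is relatively compact in $\mathcal P_2(E)$; (ii) the family of measures $(I(\mu^N))_N$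 is tight and $$\sup_N\int_{\|x\|>R}\|x\|^2\,dI(\mu^N)(x)\longrightarrow0\quad\text{as }R\to\infty;$$ (iii) every subsequence of $(\mu^N)_N$ has a further subsequence $(\mu^{N'})_{N'}$ for which there exist a probability space $(\widetilde\Omega,\widetilde{\mathcal F},\widetilde{\mathbb P})$ and random variables $\widetilde\mu^{N'},\widetilde\mu:\widetilde\Omega\to\mathcal P_2(E)$ such that $\widetilde\mu^{N'}$ has the same law as $\mu^{N'}$ for every $N'$, and $W_2[\widetilde\mu^{N'},\widetilde\mu]\to0$ as $N'\to\infty$, both $\widetilde{\mathbb P}$-almost surely and in $L^2(\widetilde\Omega)$. -/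

import Mathlib

open MeasureTheory ProbabilityTheory Filter Topology
open scoped ENNReal NNReal

universe u v w

/-- The set `Π(μ, ν)` of couplings of `μ` and `ν`: the probability measures on `E × E` with
first marginal `μ` and second marginal `ν`. -/
def couplings {E : Type*} [MeasurableSpace E] (μ ν : Measure E) : Set (Measure (E × E)) :=
  {π | IsProbabilityMeasure π ∧ π.fst = μ ∧ π.snd = ν}

/-- The quadratic Wasserstein distance
`W₂[μ, ν] = (inf over π ∈ Π(μ, ν) of ∫ ‖x - y‖² dπ(x, y)) ^ (1/2)`, with values in `[0, ∞]`. -/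
noncomputable def wassersteinTwo {E : Type*} [NormedAddCommGroup E] [MeasurableSpace E]
    (μ ν : Measure E) : ℝ≥0∞ :=
  (⨅ π ∈ couplings μ ν, ∫⁻ z, ‖z.1 - z.2‖ₑ ^ 2 ∂π) ^ (1 / 2 : ℝ)

/-- The Wasserstein space `𝒫₂(E)`: probability measures on `E` with finite second moment. -/
@[ext]
structure WassersteinSpace (E : Type*) [NormedAddCommGroup E] [MeasurableSpace E] where
  /-- the underlying measure -/
  toMeasure : Measure E
  isProbabilityMeasure : IsProbabilityMeasure toMeasure
  lintegral_lt_top : ∫⁻ x, ‖x‖ₑ ^ 2 ∂toMeasure < ∞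

namespace WassersteinSpace

instance instIsProbabilityMeasure {E : Type*} [NormedAddCommGroup E] [MeasurableSpace E]
    (μ : WassersteinSpace E) : IsProbabilityMeasure μ.toMeasure :=
  μ.isProbabilityMeasure

section Metric

theorem swap_mem_couplings {E : Type*} [MeasurableSpace E] {μ ν : Measure E} {π : Measure (E × E)} (h : π ∈ couplings μ ν) :
    π.map Prod.swap ∈ couplings ν μ := by
  obtain ⟨h0, h1, h2⟩ := h
  exact ⟨Measure.isProbabilityMeasure_map measurable_swap.aemeasurable,
    by rw [Measure.fst_map_swap, h2], by rw [Measure.snd_map_swap, h1]⟩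

variable {E : Type*} [NormedAddCommGroup E] [MeasurableSpace E]

theorem wassersteinTwo_le {μ ν : Measure E} {π : Measure (E × E)} (h : π ∈ couplings μ ν) :
    wassersteinTwo μ ν ≤ (∫⁻ z, ‖z.1 - z.2‖ₑ ^ 2 ∂π) ^ (1 / 2 : ℝ) :=
  ENNReal.rpow_le_rpow (iInf₂_le π h) (by norm_num)

theorem le_wassersteinTwo {μ ν : Measure E} {c : ℝ≥0∞}
    (h : ∀ π ∈ couplings μ ν, c ≤ (∫⁻ z, ‖z.1 - z.2‖ₑ ^ 2 ∂π) ^ (1 / 2 : ℝ)) :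
    c ≤ wassersteinTwo μ ν := by
  unfold wassersteinTwo
  rw [one_div, ENNReal.le_rpow_inv_iff (by norm_num)]
  refine le_iInf₂ fun π hπ => ?_
  have := h π hπ
  rwa [one_div, ENNReal.le_rpow_inv_iff (by norm_num)] at this

variable [BorelSpace E] [TopologicalSpace.SeparableSpace E]

theorem measurable_cost : Measurable fun z : E × E => ‖z.1 - z.2‖ₑ := by
  have : SecondCountableTopology E := UniformSpace.secondCountable_of_separable E
  fun_prop

theorem wassersteinTwo_self (μ : Measure E) [IsProbabilityMeasure μ] :
    wassersteinTwo μ μ = 0 := by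
  have hm : Measurable fun x : E => (x, x) := by fun_prop
  have hmem : μ.map (fun x : E => (x, x)) ∈ couplings μ μ := by
    refine ⟨Measure.isProbabilityMeasure_map hm.aemeasurable, ?_, ?_⟩
    · rw [Measure.fst, Measure.map_map measurable_fst hm]
      exact Measure.map_id
    · rw [Measure.snd, Measure.map_map measurable_snd hm]
      exact Measure.map_id
  refine le_antisymm ((wassersteinTwo_le hmem).trans ?_) zero_le
  rw [lintegral_map (measurable_cost.pow_const 2) hm]
  simp

theorem wassersteinTwo_comm_le (μ ν : Measure E) :
    wassersteinTwo μ ν ≤ wassersteinTwo ν μ := by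
  refine le_wassersteinTwo fun π hπ => (wassersteinTwo_le (swap_mem_couplings hπ)).trans ?_
  rw [lintegral_map (measurable_cost.pow_const 2) measurable_swap]
  simp [enorm_sub_rev]

theorem cost_ne_top (μ ν : WassersteinSpace E) :
    wassersteinTwo μ.toMeasure ν.toMeasure ≠ ∞ := by
  have : SecondCountableTopology E := UniformSpace.secondCountable_of_separable E
  have hmem : μ.toMeasure.prod ν.toMeasure ∈ couplings μ.toMeasure ν.toMeasure :=
    ⟨inferInstance, by simp, by simp⟩
  refine ((wassersteinTwo_le hmem).trans_lt ?_).ne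
  refine ENNReal.rpow_lt_top_of_nonneg (by norm_num) ?_
  have h1 : ∫⁻ z, ‖z.1‖ₑ ^ 2 ∂(μ.toMeasure.prod ν.toMeasure) < ∞ := by
    have := lintegral_map (μ := μ.toMeasure.prod ν.toMeasure) (f := fun x : E => ‖x‖ₑ ^ 2)
      (by fun_prop) measurable_fst
    rw [← this]
    have h := μ.lintegral_lt_top
    simpa using! h
  have h2 : ∫⁻ z, ‖z.2‖ₑ ^ 2 ∂(μ.toMeasure.prod ν.toMeasure) < ∞ := by
    have := lintegral_map (μ := μ.toMeasure.prod ν.toMeasure) (f := fun x : E => ‖x‖ₑ ^ 2)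
      (by fun_prop) measurable_snd
    rw [← this]
    have h := ν.lintegral_lt_top
    simpa using! h
  refine (lt_of_le_of_lt (lintegral_mono (g := fun z : E × E => 2 * ‖z.1‖ₑ ^ 2 + 2 * ‖z.2‖ₑ ^ 2)
    fun z => ?_) ?_).ne
  · have ha := enorm_sub_le (a := z.1) (b := z.2)
    calc ‖z.1 - z.2‖ₑ ^ 2 ≤ (‖z.1‖ₑ + ‖z.2‖ₑ) ^ 2 := by gcongr
      _ ≤ 2 * (‖z.1‖ₑ ^ 2 + ‖z.2‖ₑ ^ 2) := by
        simp only [enorm_eq_nnnorm]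
        norm_cast
        exact add_sq_le
      _ = _ := by ring
  · rw [lintegral_add_left (by fun_prop), lintegral_const_mul _ (by fun_prop),
      lintegral_const_mul _ (by fun_prop)]
    exact ENNReal.add_lt_top.2 ⟨ENNReal.mul_lt_top (by simp) h1, ENNReal.mul_lt_top (by simp) h2⟩

/-- Integrals of Lipschitz functions are controlled by the Wasserstein distance. -/
theorem lintegral_le_add_wassersteinTwo {L : ℝ≥0} (hL : L ≠ 0) {f : E → ℝ≥0} (hf : LipschitzWith L f)
    (μ ν : Measure E) :
    ∫⁻ x, f x ∂μ ≤ ∫⁻ x, f x ∂ν + L * wassersteinTwo μ ν := by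
  have hfm : Measurable fun x => (f x : ℝ≥0∞) := hf.continuous.measurable.coe_nnreal_ennreal
  have key : ∀ π ∈ couplings μ ν, ∫⁻ x, f x ∂μ ≤
      ∫⁻ x, f x ∂ν + L * (∫⁻ z, ‖z.1 - z.2‖ₑ ^ 2 ∂π) ^ (1 / 2 : ℝ) := by
    rintro π ⟨h0, h1, h2⟩
    have hc : ∫⁻ z, ‖z.1 - z.2‖ₑ ∂π ≤ (∫⁻ z, ‖z.1 - z.2‖ₑ ^ 2 ∂π) ^ (1 / 2 : ℝ) := by
      have : SecondCountableTopology E := UniformSpace.secondCountable_of_separable E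
      have hs : AEStronglyMeasurable (fun z : E × E => z.1 - z.2) π := by
        exact (by fun_prop : Measurable fun z : E × E => z.1 - z.2).aestronglyMeasurable
      have := eLpNorm'_le_eLpNorm'_of_exponent_le (p := 1) (q := 2) one_pos one_le_two π hs
      simpa [eLpNorm'] using this
    calc ∫⁻ x, f x ∂μ = ∫⁻ z, f z.1 ∂π := by
          rw [← h1, Measure.fst, lintegral_map hfm measurable_fst]
      _ ≤ ∫⁻ z, (f z.2 + L * ‖z.1 - z.2‖ₑ) ∂π := by
          refine lintegral_mono fun z => ?_
          have := hf z.1 z.2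
          rw [edist_eq_enorm_sub z.1] at this
          have h3 : (f z.1 : ℝ≥0∞) ≤ f z.2 + edist (f z.1) (f z.2) := by
            rw [edist_nndist]
            norm_cast
            rw [← NNReal.coe_le_coe]
            push_cast
            have := abs_le.1 (le_of_eq (NNReal.dist_eq (f z.1) (f z.2)).symm)
            linarith [this.2]
          exact h3.trans (by gcongr)
      _ = ∫⁻ x, f x ∂ν + L * ∫⁻ z, ‖z.1 - z.2‖ₑ ∂π := by
          have hf2 : Measurable fun z : E × E => (f z.2 : ℝ≥0∞) := hfm.comp measurable_snd
          rw [lintegral_add_left hf2, lintegral_const_mul _ measurable_cost,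
            ← h2, Measure.snd, lintegral_map hfm measurable_snd]
      _ ≤ _ := by gcongr
  rw [← tsub_le_iff_left]
  rw [mul_comm, ← ENNReal.div_le_iff (by simpa using hL) (by simp)]
  refine le_wassersteinTwo fun π hπ => ?_
  rw [ENNReal.div_le_iff (by simpa using hL) (by simp), tsub_le_iff_left, mul_comm]
  exact key π hπ

theorem eq_of_wassersteinTwo_eq_zero {μ ν : WassersteinSpace E}
    (h : wassersteinTwo μ.toMeasure ν.toMeasure = 0) : μ = ν := by
  have h' : wassersteinTwo ν.toMeasure μ.toMeasure = 0 :=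
    le_antisymm ((wassersteinTwo_comm_le _ _).trans h.le) zero_le
  refine WassersteinSpace.ext (ext_of_generate_finite {s | IsClosed s} ?_ isPiSystem_isClosed
    (fun F hF => ?_) (by simp))
  · rw [BorelSpace.measurable_eq (α := E), borel_eq_generateFrom_isClosed]
  have hδ : ∀ n : ℕ, (0 : ℝ) < 1 / ((n : ℝ) + 1) := fun n => by positivity
  refine tendsto_nhds_unique
    (tendsto_lintegral_thickenedIndicator_of_isClosed μ.toMeasure hF hδ
      tendsto_one_div_add_atTop_nhds_zero_nat) ?_
  refine (tendsto_lintegral_thickenedIndicator_of_isClosed ν.toMeasure hF hδ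
      tendsto_one_div_add_atTop_nhds_zero_nat).congr fun n => le_antisymm ?_ ?_
  · simpa [h'] using lintegral_le_add_wassersteinTwo (by simpa using hδ n)
      (lipschitzWith_thickenedIndicator (hδ n) F)
      ν.toMeasure μ.toMeasure
  · simpa [h] using lintegral_le_add_wassersteinTwo (by simpa using hδ n)
      (lipschitzWith_thickenedIndicator (hδ n) F)
      μ.toMeasure ν.toMeasure

variable [CompleteSpace E]

/-- Gluing of two couplings along their common marginal. -/
theorem exists_gluing {μ ν ρ : Measure E} {π₁ π₂ : Measure (E × E)}
    (h₁ : π₁ ∈ couplings μ ν) (h₂ : π₂ ∈ couplings ν ρ) :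
    ∃ γ : Measure ((E × E) × E), γ.map Prod.fst = π₁ ∧ γ.map (fun z => (z.1.2, z.2)) = π₂ := by
  have : SecondCountableTopology E := UniformSpace.secondCountable_of_separable E
  obtain ⟨hp₁, -, hs₁⟩ := h₁
  obtain ⟨hp₂, hf₂, -⟩ := h₂
  let κ : Kernel (E × E) E := π₂.condKernel.comap Prod.snd measurable_snd
  refine ⟨π₁ ⊗ₘ κ, Measure.fst_compProd π₁ κ, ?_⟩
  have hm : Measurable fun z : (E × E) × E => (z.1.2, z.2) := by fun_prop
  refine Measure.ext_of_lintegral _ fun f hf => ?_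
  have hfm : Measurable fun z : (E × E) × E => f (z.1.2, z.2) := hf.comp hm
  rw [lintegral_map hf hm, Measure.lintegral_compProd hfm]
  conv_rhs => rw [← π₂.disintegrate π₂.condKernel, Measure.lintegral_compProd hf, hf₂, ← hs₁,
    Measure.snd, lintegral_map (by fun_prop) measurable_snd]
  rfl

theorem wassersteinTwo_triangle (μ ν ρ : Measure E) :
    wassersteinTwo μ ρ ≤ wassersteinTwo μ ν + wassersteinTwo ν ρ := by
  have key : ∀ π₁ ∈ couplings μ ν, ∀ π₂ ∈ couplings ν ρ, wassersteinTwo μ ρ ≤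
      (∫⁻ z, ‖z.1 - z.2‖ₑ ^ 2 ∂π₁) ^ (1 / 2 : ℝ) + (∫⁻ z, ‖z.1 - z.2‖ₑ ^ 2 ∂π₂) ^ (1 / 2 : ℝ) := by
    intro π₁ h₁ π₂ h₂
    obtain ⟨γ, hγ₁, hγ₂⟩ := exists_gluing h₁ h₂
    have hm₂ : Measurable fun z : (E × E) × E => (z.1.2, z.2) := by fun_prop
    have hm₃ : Measurable fun z : (E × E) × E => (z.1.1, z.2) := by fun_prop
    obtain ⟨hp₁, hf₁, hs₁⟩ := h₁
    obtain ⟨hp₂, hf₂, hs₂⟩ := h₂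
    have hγ : IsProbabilityMeasure γ := by
      rw [← hγ₁] at hp₁
      exact (Measure.isProbabilityMeasure_map_iff measurable_fst.aemeasurable).1 hp₁
    have hmem : γ.map (fun z => (z.1.1, z.2)) ∈ couplings μ ρ := by
      refine ⟨Measure.isProbabilityMeasure_map hm₃.aemeasurable, ?_, ?_⟩
      · rw [← hf₁, ← hγ₁, Measure.fst, Measure.fst, Measure.map_map measurable_fst hm₃,
          Measure.map_map measurable_fst measurable_fst]
        rfl
      · rw [← hs₂, ← hγ₂, Measure.snd, Measure.snd, Measure.map_map measurable_snd hm₃,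
          Measure.map_map measurable_snd hm₂]
        rfl
    refine (wassersteinTwo_le hmem).trans ?_
    rw [← hγ₁, ← hγ₂, lintegral_map (measurable_cost.pow_const 2) hm₃,
      lintegral_map (measurable_cost.pow_const 2) hm₂,
      lintegral_map (measurable_cost.pow_const 2) measurable_fst]
    have hmink := ENNReal.lintegral_Lp_add_le (μ := γ) (p := 2)
      (measurable_cost.comp measurable_fst).aemeasurable
      (measurable_cost.comp hm₂).aemeasurable one_le_two
    simp only [Pi.add_apply, Function.comp_apply, ENNReal.rpow_two] at hmink
    refine le_trans ?_ hmink
    gcongr with z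
    simpa using enorm_add_le (z.1.1 - z.1.2) (z.1.2 - z.2)
  rw [← tsub_le_iff_right]
  refine le_wassersteinTwo fun π₁ h₁ => ?_
  rw [tsub_le_iff_right, ← tsub_le_iff_left]
  refine le_wassersteinTwo fun π₂ h₂ => ?_
  rw [tsub_le_iff_left]
  exact key π₁ h₁ π₂ h₂

end Metric

section Space

variable {E : Type*} [NormedAddCommGroup E] [MeasurableSpace E] [BorelSpace E]
  [TopologicalSpace.SeparableSpace E] [CompleteSpace E]

/-- `𝒫₂(E)` is a metric space for the distance `W₂`. -/
noncomputable instance instMetricSpace : MetricSpace (WassersteinSpace E) where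
  dist μ ν := (wassersteinTwo μ.toMeasure ν.toMeasure).toReal
  dist_self μ := by simp [wassersteinTwo_self]
  dist_comm μ ν := congrArg ENNReal.toReal
    (le_antisymm (wassersteinTwo_comm_le _ _) (wassersteinTwo_comm_le _ _))
  dist_triangle μ ν ρ := by
    rw [← ENNReal.toReal_add (cost_ne_top μ ν) (cost_ne_top ν ρ)]
    exact ENNReal.toReal_mono (ENNReal.add_ne_top.2 ⟨cost_ne_top μ ν, cost_ne_top ν ρ⟩)
      (wassersteinTwo_triangle _ _ _)
  eq_of_dist_eq_zero {μ ν} h := eq_of_wassersteinTwo_eq_zero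
    (((ENNReal.toReal_eq_zero_iff _).1 h).resolve_right (cost_ne_top μ ν))

/-- `𝒫₂(E)` carries the Borel `σ`-algebra of the distance `W₂`. -/
noncomputable instance instMeasurableSpace : MeasurableSpace (WassersteinSpace E) := borel _

instance instBorelSpace : BorelSpace (WassersteinSpace E) := ⟨rfl⟩

theorem continuous_lintegral {L : ℝ≥0} (hL : L ≠ 0) {f : E → ℝ≥0} (hf : LipschitzWith L f) :
    Continuous fun μ : WassersteinSpace E => ∫⁻ x, f x ∂μ.toMeasure := by
  have hed : ∀ μ ν : WassersteinSpace E,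
      edist μ ν = wassersteinTwo μ.toMeasure ν.toMeasure := fun μ ν => by
    rw [edist_dist]
    exact ENNReal.ofReal_toReal (cost_ne_top μ ν)
  refine continuous_of_le_add_edist L (by simp) fun μ ν => ?_
  rw [hed]
  exact lintegral_le_add_wassersteinTwo hL hf _ _

theorem measurable_toMeasure :
    Measurable (toMeasure : WassersteinSpace E → Measure E) := by
  refine Measurable.measure_of_isPiSystem_of_isProbabilityMeasure (S := {s | IsClosed s})
    (by rw [BorelSpace.measurable_eq (α := E), borel_eq_generateFrom_isClosed])
    isPiSystem_isClosed fun F hF => ?_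
  have hδ : ∀ n : ℕ, (0 : ℝ) < 1 / ((n : ℝ) + 1) := fun n => by positivity
  refine measurable_of_tendsto_metrizable (f := fun n (μ : WassersteinSpace E) =>
    ∫⁻ x, (thickenedIndicator (hδ n) F x : ℝ≥0∞) ∂μ.toMeasure) (fun n => ?_)
    (tendsto_pi_nhds.2 fun μ => tendsto_lintegral_thickenedIndicator_of_isClosed μ.toMeasure hF hδ
      tendsto_one_div_add_atTop_nhds_zero_nat)
  exact (continuous_lintegral (by simpa using hδ n)
    (lipschitzWith_thickenedIndicator (hδ n) F)).measurable

end Space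

end WassersteinSpace

/-- The intensity `I(μ)` of a random measure `μ` defined on the probability space `(Ω, P)`: the
measure on `E` with `I(μ)(A) = 𝔼[μ(A)]` for measurable `A`. -/
noncomputable def intensity {Ω E : Type*} [MeasurableSpace Ω] [NormedAddCommGroup E]
    [MeasurableSpace E] (P : Measure Ω) (μ : Ω → WassersteinSpace E) : Measure E :=
  P.bind fun ω => (μ ω).toMeasure

section Intensity

variable {Ω E : Type*} [MeasurableSpace Ω] [NormedAddCommGroup E] [MeasurableSpace E]
  [BorelSpace E] [TopologicalSpace.SeparableSpace E] [CompleteSpace E]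

/-- The defining relation `⟨f, I(μ)⟩ = 𝔼[⟨f, μ⟩]`. -/
theorem lintegral_intensity (P : Measure Ω) {μ : Ω → WassersteinSpace E} (hμ : Measurable μ)
    {f : E → ℝ≥0∞} (hf : Measurable f) :
    ∫⁻ x, f x ∂(intensity P μ) = ∫⁻ ω, ∫⁻ x, f x ∂(μ ω).toMeasure ∂P :=
  Measure.lintegral_bind (WassersteinSpace.measurable_toMeasure.comp hμ).aemeasurable
    hf.aemeasurable

theorem isProbabilityMeasure_intensity (P : Measure Ω) [IsProbabilityMeasure P]
    {μ : Ω → WassersteinSpace E} (hμ : Measurable μ) :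
    IsProbabilityMeasure (intensity P μ) := by
  constructor
  have h := lintegral_intensity P hμ (f := fun _ => 1) measurable_const
  simpa using h

/-- The intensity of a random measure, as a point of `𝒫₂(E)` when its second moment is finite. -/
noncomputable def intensityPoint (P : Measure Ω) [IsProbabilityMeasure P]
    (μ : Ω → WassersteinSpace E) (hμ : Measurable μ)
    (hI : ∫⁻ x, ‖x‖ₑ ^ 2 ∂(intensity P μ) < ∞) : WassersteinSpace E :=
  ⟨intensity P μ, isProbabilityMeasure_intensity P hμ, hI⟩

end Intensity

/-!
Minkowski's inequality along a coupling shows that `L²` norms of `1`-Lipschitz functions are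
nonexpansive for `W₂`. Testing with truncated distances to a compact set or to a base point, a
totally bounded set of measures is tight with uniformly integrable second moments. Conversely, by
Prokhorov such a set is sequentially relatively compact for weak convergence, and weak convergence
yields couplings that are close to the diagonal off an event of small probability, on which uniform
integrability controls the cost; these couplings are built cell by cell on a countable partition
into small cells with null frontiers.

For random measures, `𝒫₂(E)` is itself Polish. If the intensities satisfy (ii), then Markov's
inequality along the sets `{m | ∀ j, m Kⱼᶜ + tailNorm m ≤ 2⁻ʲ}`, which are relatively compact in
`𝒫₂(E)`, makes the laws on `𝒫₂(E)` tight, and they have uniformly integrable second moments.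
Couplings of the laws with a weak limit, of cost at most `2⁻ᵏ`, are then realised simultaneously on
one space by disintegration over their common marginal; the costs being summable, convergence is
almost sure. In the other direction Minkowski's inequality on `Ω'` compares `L²` norms of Lipschitz
functions under the intensities with the `L²` distance of the random measures, so no measurable
selection of couplings is needed.
-/

section Coupling

theorem exists_coupling_ge {S : Type*} [MeasurableSpace S] {μ ν : Measure S}
    [IsProbabilityMeasure μ] [IsProbabilityMeasure ν] {γ : Measure (S × S)} (hμ : γ.fst ≤ μ)
    (hν : γ.snd ≤ ν) : ∃ π ∈ couplings μ ν, γ ≤ π := by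
  have hγ : γ Set.univ ≠ ∞ := by
    rw [← Measure.fst_univ]
    exact ((hμ _).trans_lt (measure_lt_top μ _)).ne
  have : IsFiniteMeasure γ := ⟨hγ.lt_top⟩
  have hμ' : μ - γ.fst + γ.fst = μ := Measure.sub_add_cancel_of_le hμ
  have hν' : ν - γ.snd + γ.snd = ν := Measure.sub_add_cancel_of_le hν
  set α := μ - γ.fst
  set β := ν - γ.snd
  have hmass : β Set.univ = α Set.univ := by
    have hα := congrArg (· Set.univ) hμ'
    have hβ := congrArg (· Set.univ) hν'
    simp only [Measure.add_apply, Measure.fst_univ, Measure.snd_univ, measure_univ] at hα hβ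
    exact (ENNReal.add_left_inj hγ).1 (hβ.trans hα.symm)
  have cancel : ∀ m : Measure S, m Set.univ = α Set.univ →
      (α Set.univ)⁻¹ • α Set.univ • m = m := fun m hm => by
    by_cases h0 : α Set.univ = 0
    · rw [Measure.measure_univ_eq_zero.1 (hm.trans h0), smul_zero, smul_zero]
    · rw [smul_smul, ENNReal.inv_mul_cancel h0 (measure_ne_top α _), one_smul]
  have hfst : (γ + (α Set.univ)⁻¹ • α.prod β).fst = μ := by
    rw [Measure.fst_add, Measure.fst, Measure.fst, Measure.map_smul, Measure.map_fst_prod, hmass,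
      cancel α rfl, add_comm, ← Measure.fst, hμ']
  have hsnd : (γ + (α Set.univ)⁻¹ • α.prod β).snd = ν := by
    rw [Measure.snd_add, Measure.snd, Measure.snd, Measure.map_smul, Measure.map_snd_prod,
      cancel β hmass, add_comm, ← Measure.snd, hν']
  refine ⟨_, ⟨⟨?_⟩, hfst, hsnd⟩, Measure.le_add_right le_rfl⟩
  rw [← Measure.fst_univ, hfst, measure_univ]

theorem sum_smul_restrict_le {S ι : Type*} [MeasurableSpace S] [Countable ι] (μ : Measure S)
    {B : ι → Set S} (hB : ∀ i, MeasurableSet (B i)) (hd : Pairwise (Function.onFun Disjoint B))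
    {w : ι → ℝ≥0∞} (hw : ∀ i, w i ≤ 1) :
    Measure.sum (fun i => w i • μ.restrict (B i)) ≤ μ := by
  calc Measure.sum (fun i => w i • μ.restrict (B i))
      ≤ Measure.sum fun i => μ.restrict (B i) := by
        refine Measure.le_iff.2 fun A hA => ?_
        simp only [Measure.sum_apply _ hA, Measure.smul_apply, smul_eq_mul]
        gcongr with i
        exact mul_le_of_le_one_left zero_le (hw i)
    _ ≤ μ := by
        rw [← Measure.restrict_iUnion hd hB]
        exact Measure.restrict_le_self

theorem exists_coupling_tsum_min_le {S ι : Type*} [MeasurableSpace S] [Countable ι]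
    (μ ν : Measure S) [IsProbabilityMeasure μ] [IsProbabilityMeasure ν] {B : ι → Set S}
    (hB : ∀ i, MeasurableSet (B i)) (hd : Pairwise (Function.onFun Disjoint B)) :
    ∃ π ∈ couplings μ ν, ∑' i, min (μ (B i)) (ν (B i)) ≤ π (⋃ i, B i ×ˢ B i) := by
  -- the weights for which the block `B i` receives mass `min (μ (B i)) (ν (B i))`
  let c : ι → ℝ≥0∞ := fun i => (max (μ (B i)) (ν (B i)))⁻¹
  have hcμ : ∀ i, c i * μ (B i) ≤ 1 := fun i => by
    rw [mul_comm, ← div_eq_mul_inv]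
    exact ENNReal.div_le_of_le_mul (by simp)
  have hcν : ∀ i, c i * ν (B i) ≤ 1 := fun i => by
    rw [mul_comm, ← div_eq_mul_inv]
    exact ENNReal.div_le_of_le_mul (by simp)
  have hc : ∀ i, min (μ (B i)) (ν (B i)) ≤ c i * (μ (B i) * ν (B i)) := fun i => by
    by_cases h0 : max (μ (B i)) (ν (B i)) = 0
    · exact min_le_max.trans (h0.le.trans zero_le)
    · rw [← min_mul_max (μ (B i)), mul_left_comm, ENNReal.inv_mul_cancel h0
        (max_lt (measure_lt_top μ _) (measure_lt_top ν _)).ne, mul_one]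
  let γ : ι → Measure (S × S) := fun i => c i • (μ.restrict (B i)).prod (ν.restrict (B i))
  have hfst : (Measure.sum γ).fst ≤ μ := by
    rw [Measure.fst_sum]
    simp only [γ, Measure.fst, Measure.map_smul, Measure.map_fst_prod,
      Measure.restrict_apply_univ, smul_smul]
    exact sum_smul_restrict_le μ hB hd hcν
  have hsnd : (Measure.sum γ).snd ≤ ν := by
    rw [Measure.snd_sum]
    simp only [γ, Measure.snd, Measure.map_smul, Measure.map_snd_prod,
      Measure.restrict_apply_univ, smul_smul]
    exact sum_smul_restrict_le ν hB hd hcμ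
  obtain ⟨π, hπ, hγπ⟩ := exists_coupling_ge hfst hsnd
  refine ⟨π, hπ, le_trans ?_ (hγπ _)⟩
  rw [Measure.sum_apply _ (.iUnion fun i => (hB i).prod (hB i))]
  refine ENNReal.tsum_le_tsum fun i => (hc i).trans ?_
  refine le_trans (le_of_eq ?_) (measure_mono (Set.subset_iUnion (fun i => B i ×ˢ B i) i))
  rw [Measure.smul_apply, smul_eq_mul, Measure.prod_prod, Measure.restrict_apply_self,
    Measure.restrict_apply_self]

theorem exists_partition_null_frontier {S : Type*} [PseudoMetricSpace S]
    [TopologicalSpace.SeparableSpace S] [MeasurableSpace S] [OpensMeasurableSpace S]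
    (μ : Measure S) [SFinite μ] {ε : ℝ} (hε : 0 < ε) :
    ∃ B : ℕ → Set S, (∀ i, MeasurableSet (B i)) ∧ (∀ i, μ (frontier (B i)) = 0) ∧
      Pairwise (Function.onFun Disjoint B) ∧ ⋃ i, B i = Set.univ ∧
      ∀ i, ∀ x ∈ B i, ∀ y ∈ B i, dist x y ≤ ε := by
  rcases isEmpty_or_nonempty S with hS | hS
  · exact ⟨fun _ => ∅, by simp, by simp, fun _ _ _ => by simp, Subsingleton.elim _ _, by simp⟩
  let s := TopologicalSpace.denseSeq S
  choose r hr hr0 using fun n => exists_null_frontier_thickening μ {s n}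
    (show ε / 4 < ε / 2 by linarith)
  simp only [Metric.thickening_singleton] at hr0
  let ball : ℕ → Set S := fun n => Metric.ball (s n) (r n)
  refine ⟨disjointed ball, fun i => ?_, fun i => ?_, disjoint_disjointed ball, ?_, ?_⟩
  · exact disjointedRec (fun _ _ ht => ht.diff Metric.isOpen_ball.measurableSet)
      Metric.isOpen_ball.measurableSet
  · refine disjointedRec (p := fun t => μ (frontier t) = 0) (fun t n ht => ?_) (hr0 i)
    rw [Set.sdiff_eq]
    exact null_frontier_inter ht ((congrArg μ (frontier_compl (ball n))).trans (hr0 n))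
  · rw [iUnion_disjointed]
    refine Set.eq_univ_of_forall fun x => ?_
    obtain ⟨n, hn⟩ := (TopologicalSpace.denseRange_denseSeq S).exists_dist_lt x
      (show 0 < ε / 4 by linarith)
    exact Set.mem_iUnion.2 ⟨n, Metric.mem_ball.2 (hn.trans (hr n).1)⟩
  · intro i x hx y hy
    have hxi : dist x (s i) < r i := disjointed_subset ball i hx
    have hyi : dist y (s i) < r i := disjointed_subset ball i hy
    linarith [dist_triangle_right x y (s i), (hr i).2]

theorem eventually_lt_tsum_min_of_tendsto {S ι : Type*} [TopologicalSpace S] [MeasurableSpace S]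
    [OpensMeasurableSpace S] [HasOuterApproxClosed S] {l : Filter ι} {μ : ProbabilityMeasure S}
    {μs : ι → ProbabilityMeasure S} (h : Tendsto μs l (𝓝 μ)) {B : ℕ → Set S}
    (hB : ∀ i, MeasurableSet (B i)) (hB0 : ∀ i, (μ : Measure S) (frontier (B i)) = 0)
    (hd : Pairwise (Function.onFun Disjoint B)) (hU : ⋃ i, B i = Set.univ) {c : ℝ≥0∞}
    (hc : c < 1) :
    ∀ᶠ n in l, c < ∑' i, min ((μ : Measure S) (B i)) ((μs n : Measure S) (B i)) := by
  have hsum : ∑' i, (μ : Measure S) (B i) = 1 := by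
    rw [← measure_iUnion hd hB, hU, measure_univ]
  obtain ⟨k, hk⟩ : ∃ k, c < ∑ i ∈ Finset.range k, (μ : Measure S) (B i) :=
    ((ENNReal.tendsto_nat_tsum fun i => (μ : Measure S) (B i)).eventually
      (lt_mem_nhds (hc.trans_eq hsum.symm))).exists
  have hlim : Tendsto (fun n => ∑ i ∈ Finset.range k,
      min ((μ : Measure S) (B i)) ((μs n : Measure S) (B i))) l
      (𝓝 (∑ i ∈ Finset.range k, (μ : Measure S) (B i))) := by
    refine tendsto_finsetSum _ fun i _ => ?_
    simpa only [min_self] using (tendsto_const_nhds (x := (μ : Measure S) (B i))).min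
      (ProbabilityMeasure.tendsto_measure_of_null_frontier_of_tendsto' h (hB0 i))
  filter_upwards [hlim.eventually (lt_mem_nhds hk)] with n hn
  exact hn.trans_le (ENNReal.sum_le_tsum _)

theorem eventually_exists_coupling_of_tendsto {S ι : Type*} [PseudoMetricSpace S]
    [TopologicalSpace.SeparableSpace S] [MeasurableSpace S] [BorelSpace S] {l : Filter ι}
    {μ : ProbabilityMeasure S} {μs : ι → ProbabilityMeasure S} (h : Tendsto μs l (𝓝 μ))
    {ε : ℝ} (hε : 0 < ε) {η : ℝ≥0∞} (hη : η ≠ 0) :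
    ∀ᶠ n in l, ∃ π ∈ couplings (μ : Measure S) (μs n), π {z | ε < dist z.1 z.2} ≤ η := by
  obtain ⟨B, hB, hB0, hd, hU, hdiam⟩ := exists_partition_null_frontier (μ : Measure S) hε
  filter_upwards [eventually_lt_tsum_min_of_tendsto h hB hB0 hd hU
    (ENNReal.sub_lt_self ENNReal.one_ne_top one_ne_zero hη)] with n hn
  obtain ⟨π, hπ, hle⟩ := exists_coupling_tsum_min_le (μ : Measure S) (μs n) hB hd
  have := hπ.1
  refine ⟨π, hπ, ?_⟩
  have hsub : {z : S × S | ε < dist z.1 z.2} ⊆ (⋃ i, B i ×ˢ B i)ᶜ := by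
    intro z hz hmem
    obtain ⟨i, hi⟩ := Set.mem_iUnion.1 hmem
    exact (hdiam i _ hi.1 _ hi.2).not_gt hz
  calc π {z | ε < dist z.1 z.2} ≤ π (⋃ i, B i ×ˢ B i)ᶜ := measure_mono hsub
    _ = 1 - π (⋃ i, B i ×ˢ B i) := prob_compl_eq_one_sub (.iUnion fun i => (hB i).prod (hB i))
    _ ≤ η := tsub_le_iff_tsub_le.1 (hn.le.trans hle)

end Coupling

section LipschitzNorms

theorem eLpNorm_two_eq_lintegral {α F : Type*} [MeasurableSpace α] [ENorm F] (f : α → F)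
    (μ : Measure α) : eLpNorm f 2 μ = (∫⁻ x, ‖f x‖ₑ ^ 2 ∂μ) ^ (1 / 2 : ℝ) := by
  simp [eLpNorm_eq_lintegral_rpow_enorm_toReal]

theorem sq_eLpNorm_two {α F : Type*} [MeasurableSpace α] [ENorm F] (f : α → F) (μ : Measure α) :
    eLpNorm f 2 μ ^ 2 = ∫⁻ x, ‖f x‖ₑ ^ 2 ∂μ := by
  simpa using eLpNorm_nnreal_pow_eq_lintegral (μ := μ) (f := f) (two_ne_zero (α := ℝ≥0))

theorem eLpNorm_le_of_tendsto {S : Type*} [TopologicalSpace S] [MeasurableSpace S]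
    [OpensMeasurableSpace S] [HasOuterApproxClosed S] {μ : ProbabilityMeasure S}
    {μs : ℕ → ProbabilityMeasure S} (h : Tendsto μs atTop (𝓝 μ)) {g : S → ℝ} (hg : Continuous g)
    {c : ℝ≥0∞} (hc : ∀ n, eLpNorm g 2 (μs n : Measure S) ≤ c) :
    eLpNorm g 2 (μ : Measure S) ≤ c := by
  have hsq : ∀ ν : Measure S, ∫⁻ x, ENNReal.ofReal (g x ^ 2) ∂ν = eLpNorm g 2 ν ^ 2 := fun ν => by
    simp only [sq_eLpNorm_two, Real.enorm_eq_ofReal_abs, ← ENNReal.ofReal_pow (abs_nonneg _),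
      sq_abs]
  have hlow := lintegral_le_liminf_lintegral_of_forall_isOpen_measure_le_liminf_measure
    (f := fun x => g x ^ 2) (hg.pow 2) (fun x => sq_nonneg (g x))
    (fun G hG => ProbabilityMeasure.le_liminf_measure_open_of_tendsto h hG)
  simp only [hsq] at hlow
  refine (ENNReal.pow_le_pow_left_iff two_ne_zero).1 (hlow.trans ?_)
  refine (liminf_le_liminf (Eventually.of_forall fun n => ?_)).trans (liminf_const _).le
  gcongr
  exact hc n

variable {S : Type*} [PseudoMetricSpace S] [MeasurableSpace S]

/-- `ν` is `ε`-close to `ρ` when tested in `L²` norm against `1`-Lipschitz functions. Two measures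
at Wasserstein distance at most `ε` are `ε`-close, and unlike the Wasserstein bound this relation
passes to intensities of random measures without a measurable choice of couplings. -/
def LipschitzL2Close (ε : ℝ≥0∞) (ν ρ : Measure S) : Prop :=
  ∀ g : S → ℝ, LipschitzWith 1 g → eLpNorm g 2 ν ≤ eLpNorm g 2 ρ + ε

theorem LipschitzL2Close.refl (ε : ℝ≥0∞) (ν : Measure S) : LipschitzL2Close ε ν ν :=
  fun _ _ => le_self_add

theorem LipschitzL2Close.mono {ε ε' : ℝ≥0∞} {ν ρ : Measure S} (h : LipschitzL2Close ε ν ρ)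
    (hε : ε ≤ ε') : LipschitzL2Close ε' ν ρ :=
  fun g hg => (h g hg).trans (by gcongr)

theorem lipschitzL2Close_of_mem_couplings [OpensMeasurableSpace S]
    [SecondCountableTopology S] {ν ρ : Measure S} {π : Measure (S × S)}
    (hπ : π ∈ couplings ν ρ) : LipschitzL2Close (eLpNorm (fun z => dist z.1 z.2) 2 π) ν ρ := by
  intro g hg
  have hgm : AEStronglyMeasurable g π.fst := hg.continuous.measurable.aestronglyMeasurable
  have hgm' : AEStronglyMeasurable g π.snd := hg.continuous.measurable.aestronglyMeasurable
  rw [← hπ.2.1, ← hπ.2.2, Measure.fst, Measure.snd,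
    eLpNorm_map_measure hgm measurable_fst.aemeasurable,
    eLpNorm_map_measure hgm' measurable_snd.aemeasurable]
  calc eLpNorm (g ∘ Prod.fst) 2 π
      ≤ eLpNorm (fun z => g (Prod.snd z)) 2 π + eLpNorm (fun z => g z.1 - g z.2) 2 π := by
        refine le_trans (le_of_eq ?_) (eLpNorm_add_le (hgm'.comp_measurable measurable_snd)
          ((hgm.comp_measurable measurable_fst).sub (hgm'.comp_measurable measurable_snd))
          one_le_two)
        congr 1
        ext z
        simp
    _ ≤ eLpNorm (g ∘ Prod.snd) 2 π + eLpNorm (fun z => dist z.1 z.2) 2 π := by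
        refine add_le_add le_rfl (eLpNorm_mono_real fun z => ?_)
        simpa [dist_eq_norm] using hg.dist_le_mul z.1 z.2

end LipschitzNorms

section UniformIntegrability

variable {S : Type*} [PseudoMetricSpace S]

/-- The distance from `x` to the ball of radius `R` around `x₀` in the radial sense,
`(d(x, x₀) - R)⁺`. -/
noncomputable def radialExcess (x₀ : S) (R : ℝ) (x : S) : ℝ :=
  max (dist x x₀ - R) 0

theorem radialExcess_nonneg (x₀ : S) (R : ℝ) (x : S) : 0 ≤ radialExcess x₀ R x :=
  le_max_right _ _

theorem dist_le_add_radialExcess (x₀ : S) (R : ℝ) (x : S) :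
    dist x x₀ ≤ R + radialExcess x₀ R x :=
  sub_le_iff_le_add'.1 (le_max_left _ _)

theorem radialExcess_anti (x₀ x : S) : Antitone fun R => radialExcess x₀ R x :=
  fun _ _ h => max_le_max_right _ (sub_le_sub_left h _)

theorem lipschitzWith_radialExcess (x₀ : S) (R : ℝ) : LipschitzWith 1 (radialExcess x₀ R) := by
  have h : LipschitzWith 1 fun x => dist x x₀ - R := .of_dist_le_mul fun x y => by
    simpa [Real.dist_eq] using abs_dist_sub_le x y x₀
  exact h.max_const 0

variable [MeasurableSpace S]

/-- The size in `L²(ν)` of the part of the distance to `x₀` beyond `R`. It plays the role of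
the truncated second moment `∫_{d(x, x₀) > R} d(x, x₀)² dν`, to which it is comparable, but is the
norm of a `1`-Lipschitz function. -/
noncomputable def tailNorm (x₀ : S) (R : ℝ) (ν : Measure S) : ℝ≥0∞ :=
  eLpNorm (radialExcess x₀ R) 2 ν

theorem tailNorm_anti (x₀ : S) (ν : Measure S) : Antitone fun R => tailNorm x₀ R ν :=
  fun _ _ h => eLpNorm_mono_real fun x => by
    rw [Real.norm_of_nonneg (radialExcess_nonneg _ _ _)]
    exact radialExcess_anti x₀ x h

/-- Uniform integrability of `d(·, x₀)²` over a set of measures. -/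
def UnifSqIntegrable (x₀ : S) (A : Set (Measure S)) : Prop :=
  ∀ δ : ℝ≥0∞, δ ≠ 0 → ∃ R : ℝ, ∀ ν ∈ A, tailNorm x₀ R ν ≤ δ

theorem UnifSqIntegrable.mono {x₀ : S} {A B : Set (Measure S)} (hB : UnifSqIntegrable x₀ B)
    (h : A ⊆ B) : UnifSqIntegrable x₀ A :=
  fun δ hδ => (hB δ hδ).imp fun _ hR ν hν => hR ν (h hν)

theorem UnifSqIntegrable.exists_nonneg {x₀ : S} {A : Set (Measure S)} (hA : UnifSqIntegrable x₀ A)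
    {δ : ℝ≥0∞} (hδ : δ ≠ 0) : ∃ R : ℝ, 0 ≤ R ∧ ∀ ν ∈ A, tailNorm x₀ R ν ≤ δ := by
  obtain ⟨R, hR⟩ := hA δ hδ
  exact ⟨max R 0, le_max_right _ _,
    fun ν hν => (tailNorm_anti x₀ ν (le_max_left _ _)).trans (hR ν hν)⟩

theorem UnifSqIntegrable.union {x₀ : S} {A B : Set (Measure S)} (hA : UnifSqIntegrable x₀ A)
    (hB : UnifSqIntegrable x₀ B) : UnifSqIntegrable x₀ (A ∪ B) := by
  intro δ hδ
  obtain ⟨R, hR⟩ := hA δ hδ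
  obtain ⟨R', hR'⟩ := hB δ hδ
  refine ⟨max R R', fun ν hν => ?_⟩
  rcases hν with hν | hν
  · exact (tailNorm_anti x₀ ν (le_max_left _ _)).trans (hR ν hν)
  · exact (tailNorm_anti x₀ ν (le_max_right _ _)).trans (hR' ν hν)

theorem UnifSqIntegrable.of_lipschitzL2Close {x₀ : S} {A : Set (Measure S)}
    (h : ∀ ε : ℝ≥0∞, ε ≠ 0 → ∃ F, UnifSqIntegrable x₀ F ∧ ∀ ν ∈ A, ∃ ρ ∈ F,
      LipschitzL2Close ε ν ρ) : UnifSqIntegrable x₀ A := by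
  intro δ hδ
  have hδ2 : δ / 2 ≠ 0 := by simpa using hδ
  obtain ⟨F, hF, hAF⟩ := h (δ / 2) hδ2
  obtain ⟨R, hR⟩ := hF (δ / 2) hδ2
  refine ⟨R, fun ν hν => ?_⟩
  obtain ⟨ρ, hρ, hνρ⟩ := hAF ν hν
  calc tailNorm x₀ R ν ≤ tailNorm x₀ R ρ + δ / 2 := hνρ _ (lipschitzWith_radialExcess x₀ R)
    _ ≤ δ / 2 + δ / 2 := by gcongr; exact hR ρ hρ
    _ = δ := ENNReal.add_halves δ

end UniformIntegrability

theorem dist_le_add_indicator_add_radialExcess {S : Type*} [PseudoMetricSpace S] (x₀ : S)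
    (R : ℝ) {ε : ℝ} (hε : 0 ≤ ε) (z : S × S) :
    dist z.1 z.2 ≤ ε + {z : S × S | ε < dist z.1 z.2}.indicator (fun _ => 2 * R) z +
      radialExcess x₀ R z.1 + radialExcess x₀ R z.2 := by
  have h₁ := radialExcess_nonneg x₀ R z.1
  have h₂ := radialExcess_nonneg x₀ R z.2
  by_cases hz : ε < dist z.1 z.2
  · rw [Set.indicator_of_mem (by exact hz)]
    linarith [dist_triangle_right z.1 z.2 x₀, dist_le_add_radialExcess x₀ R z.1,
      dist_le_add_radialExcess x₀ R z.2]
  · rw [Set.indicator_of_notMem (by exact hz)]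
    linarith [not_lt.1 hz]

section CouplingCost

variable {S : Type*} [PseudoMetricSpace S] [MeasurableSpace S] [BorelSpace S]
  [SecondCountableTopology S]

theorem eLpNorm_dist_le_of_mem_couplings {μ ν : Measure S} {π : Measure (S × S)}
    (hπ : π ∈ couplings μ ν) (x₀ : S) {ε R : ℝ} (hε : 0 ≤ ε) (hR : 0 ≤ R) :
    eLpNorm (fun z => dist z.1 z.2) 2 π ≤ ENNReal.ofReal ε +
      ENNReal.ofReal (2 * R) * π {z | ε < dist z.1 z.2} ^ (1 / 2 : ℝ) +
      tailNorm x₀ R μ + tailNorm x₀ R ν := by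
  have := hπ.1
  set D := {z : S × S | ε < dist z.1 z.2}
  have hD : MeasurableSet D := (isOpen_lt continuous_const continuous_dist).measurableSet
  have hf : AEStronglyMeasurable (fun _ : S × S => ε) π := aestronglyMeasurable_const
  have hg : AEStronglyMeasurable (D.indicator fun _ => 2 * R) π :=
    aestronglyMeasurable_const.indicator hD
  have hm : Measurable (radialExcess x₀ R) :=
    (lipschitzWith_radialExcess x₀ R).continuous.measurable
  have h₁ : AEStronglyMeasurable (radialExcess x₀ R ∘ Prod.fst) π :=
    (hm.comp measurable_fst).aestronglyMeasurable
  have h₂ : AEStronglyMeasurable (radialExcess x₀ R ∘ Prod.snd) π :=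
    (hm.comp measurable_snd).aestronglyMeasurable
  calc eLpNorm (fun z => dist z.1 z.2) 2 π
      ≤ eLpNorm ((fun _ => ε) + D.indicator (fun _ => 2 * R) + radialExcess x₀ R ∘ Prod.fst +
          radialExcess x₀ R ∘ Prod.snd) 2 π :=
        eLpNorm_mono_real fun z => (Real.norm_of_nonneg dist_nonneg).trans_le
          (dist_le_add_indicator_add_radialExcess x₀ R hε z)
    _ ≤ eLpNorm (fun _ => ε) 2 π + eLpNorm (D.indicator fun _ => 2 * R) 2 π +
          eLpNorm (radialExcess x₀ R ∘ Prod.fst) 2 π +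
          eLpNorm (radialExcess x₀ R ∘ Prod.snd) 2 π :=
        (eLpNorm_add_le ((hf.add hg).add h₁) h₂ one_le_two).trans <| add_le_add
          ((eLpNorm_add_le (hf.add hg) h₁ one_le_two).trans <| add_le_add
            (eLpNorm_add_le hf hg one_le_two) le_rfl) le_rfl
    _ = _ := by
        rw [eLpNorm_const' _ two_ne_zero ENNReal.ofNat_ne_top,
          eLpNorm_indicator_const hD two_ne_zero ENNReal.ofNat_ne_top, measure_univ,
          ENNReal.one_rpow, mul_one, Real.enorm_of_nonneg hε, Real.enorm_of_nonneg (by positivity),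
          ENNReal.toReal_ofNat, tailNorm, tailNorm, ← hπ.2.1, ← hπ.2.2, Measure.fst, Measure.snd,
          eLpNorm_map_measure hm.aestronglyMeasurable measurable_fst.aemeasurable,
          eLpNorm_map_measure hm.aestronglyMeasurable measurable_snd.aemeasurable]

theorem eventually_exists_coupling_cost_le {μ : ProbabilityMeasure S}
    {μs : ℕ → ProbabilityMeasure S} (h : Tendsto μs atTop (𝓝 μ)) {x₀ : S}
    (hU : UnifSqIntegrable x₀ (Set.range fun n => (μs n : Measure S))) {ε : ℝ≥0∞} (hε : ε ≠ 0) :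
    ∀ᶠ n in atTop, ∃ π ∈ couplings (μ : Measure S) (μs n),
      eLpNorm (fun z => dist z.1 z.2) 2 π ≤ ε := by
  obtain ⟨δ, hδ0, hδε⟩ := ENNReal.lt_iff_exists_nnreal_btwn.1
    (ENNReal.div_pos hε (ENNReal.ofNat_ne_top (n := 4)))
  obtain ⟨R, hR0, hR⟩ := hU.exists_nonneg hδ0.ne'
  have htail : tailNorm x₀ R μ ≤ δ := eLpNorm_le_of_tendsto h
    (lipschitzWith_radialExcess x₀ R).continuous fun n => hR _ ⟨n, rfl⟩
  have hη : ((δ : ℝ≥0∞) / (ENNReal.ofReal (2 * R) + 1)) ^ 2 ≠ 0 :=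
    pow_ne_zero 2 (ENNReal.div_pos hδ0.ne' (by finiteness)).ne'
  filter_upwards [eventually_exists_coupling_of_tendsto h
    (NNReal.coe_pos.2 (ENNReal.coe_pos.1 hδ0)) hη] with n ⟨π, hπ, hπδ⟩
  refine ⟨π, hπ, ?_⟩
  have hmid : ENNReal.ofReal (2 * R) * π {z | (δ : ℝ) < dist z.1 z.2} ^ (1 / 2 : ℝ) ≤ δ := by
    calc _ ≤ (ENNReal.ofReal (2 * R) + 1) * (δ / (ENNReal.ofReal (2 * R) + 1)) := by
          gcongr
          · exact le_self_add
          · rw [one_div, ENNReal.rpow_inv_le_iff two_pos]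
            exact_mod_cast hπδ
      _ ≤ δ := ENNReal.mul_div_le
  calc eLpNorm (fun z => dist z.1 z.2) 2 π ≤ δ + δ + δ + δ := by
        refine (eLpNorm_dist_le_of_mem_couplings hπ x₀ δ.2 hR0).trans ?_
        rw [NNReal.val_eq_coe, ENNReal.ofReal_coe_nnreal]
        gcongr
        exact hR _ ⟨n, rfl⟩
    _ = δ * 4 := by ring
    _ ≤ ε := ENNReal.mul_le_of_le_div hδε.le

end CouplingCost

section TruncatedMoments

variable {S : Type*} [PseudoMetricSpace S] [MeasurableSpace S] [OpensMeasurableSpace S]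

theorem sq_tailNorm_le (x₀ : S) {R : ℝ} (hR : 0 ≤ R) (ν : Measure S) :
    tailNorm x₀ R ν ^ 2 ≤ ∫⁻ x in {x | R < dist x x₀}, edist x x₀ ^ 2 ∂ν := by
  rw [tailNorm, sq_eLpNorm_two, ← lintegral_indicator
    (measurableSet_lt measurable_const (by fun_prop : Continuous fun x => dist x x₀).measurable)]
  refine lintegral_mono fun x => ?_
  rw [Real.enorm_of_nonneg (radialExcess_nonneg _ _ _), radialExcess]
  by_cases hx : R < dist x x₀
  · rw [Set.indicator_of_mem (by exact hx), edist_dist]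
    gcongr
    exact max_le (sub_le_self _ hR) dist_nonneg
  · rw [max_eq_right (sub_nonpos.2 (not_lt.1 hx))]
    simp

theorem lintegral_sq_edist_le_sq_tailNorm (x₀ : S) (R : ℝ) (ν : Measure S) :
    ∫⁻ x in {x | 2 * R < dist x x₀}, edist x x₀ ^ 2 ∂ν ≤ 4 * tailNorm x₀ R ν ^ 2 := by
  have hm : Measurable fun x => ‖radialExcess x₀ R x‖ₑ ^ 2 :=
    ((lipschitzWith_radialExcess x₀ R).continuous.measurable.enorm).pow_const 2
  rw [tailNorm, sq_eLpNorm_two, ← lintegral_const_mul _ hm]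
  refine (setLIntegral_mono (hm.const_mul 4) fun x hx => ?_).trans (setLIntegral_le_lintegral _ _)
  have hx' : dist x x₀ ≤ 2 * radialExcess x₀ R x := by
    linarith [dist_le_add_radialExcess x₀ R x, show 2 * R < dist x x₀ from hx]
  calc edist x x₀ ^ 2 ≤ ENNReal.ofReal (2 * radialExcess x₀ R x) ^ 2 := by
        rw [edist_dist]
        gcongr
    _ = 4 * ‖radialExcess x₀ R x‖ₑ ^ 2 := by
        rw [ENNReal.ofReal_mul zero_le_two, mul_pow,
          Real.enorm_of_nonneg (radialExcess_nonneg _ _ _)]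
        norm_num

theorem unifSqIntegrable_range_iff {ι : Type*} {ν : ι → Measure S} (x₀ : S) :
    UnifSqIntegrable x₀ (Set.range ν) ↔
      Tendsto (fun R : ℝ => ⨆ i, ∫⁻ x in {x | R < dist x x₀}, edist x x₀ ^ 2 ∂ν i) atTop
        (𝓝 0) := by
  rw [ENNReal.tendsto_nhds_zero]
  refine ⟨fun h ε hε => ?_, fun h δ hδ => ?_⟩
  · obtain ⟨R, hR⟩ := h ((ε / 4) ^ (1 / 2 : ℝ)) (by simp [hε.ne'])
    filter_upwards [eventually_ge_atTop (2 * R)] with r hr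
    refine iSup_le fun i => ?_
    calc ∫⁻ x in {x | r < dist x x₀}, edist x x₀ ^ 2 ∂ν i
        ≤ ∫⁻ x in {x | 2 * R < dist x x₀}, edist x x₀ ^ 2 ∂ν i :=
          lintegral_mono_set fun x hx => hr.trans_lt hx
      _ ≤ 4 * tailNorm x₀ R (ν i) ^ 2 := lintegral_sq_edist_le_sq_tailNorm x₀ R (ν i)
      _ ≤ 4 * (ε / 4) := by
          gcongr
          calc _ ≤ ((ε / 4) ^ (1 / 2 : ℝ)) ^ 2 := by gcongr; exact hR _ ⟨i, rfl⟩
            _ = ε / 4 := by rw [← ENNReal.rpow_natCast, ← ENNReal.rpow_mul]; simp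
      _ ≤ ε := ENNReal.mul_div_le
  · obtain ⟨R, hR, hR0⟩ := ((h (δ ^ 2) (ENNReal.pow_pos (pos_iff_ne_zero.2 hδ) 2)).and
      (eventually_ge_atTop 0)).exists
    refine ⟨R, Set.forall_mem_range.2 fun i => (ENNReal.pow_le_pow_left_iff two_ne_zero).1 ?_⟩
    exact (sq_tailNorm_le x₀ hR0 (ν i)).trans ((iSup_le_iff.1 hR) i)

end TruncatedMoments

section Tightness

theorem isCompact_iInter_cthickening {X : Type*} [PseudoMetricSpace X] [CompleteSpace X]
    {K : ℕ → Set X} (hK : ∀ n, IsCompact (K n)) :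
    IsCompact (⋂ n : ℕ, Metric.cthickening (1 / ((n : ℝ) + 1)) (K n)) := by
  refine TotallyBounded.isCompact_of_isClosed (Metric.totallyBounded_iff.2 fun e he => ?_)
    (isClosed_iInter fun n => Metric.isClosed_cthickening)
  obtain ⟨n, hn⟩ := exists_nat_one_div_lt (half_pos he)
  obtain ⟨t, -, ht, hKt⟩ := (hK n).finite_cover_balls (half_pos he)
  refine ⟨t, ht, fun x hx => ?_⟩
  obtain ⟨z, hz, hxz⟩ := Metric.mem_thickening_iff.1
    (Metric.cthickening_subset_thickening' (half_pos he) hn (K n) (Set.mem_iInter.1 hx n))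
  obtain ⟨y, hy, hzy⟩ := Set.mem_iUnion₂.1 (hKt hz)
  refine Set.mem_iUnion₂.2 ⟨y, hy, ?_⟩
  rw [Metric.mem_ball] at hzy ⊢
  linarith [dist_triangle x z y]

theorem isTightMeasureSet_of_thickening {X : Type*} [PseudoMetricSpace X] [CompleteSpace X]
    [MeasurableSpace X] {A : Set (Measure X)}
    (h : ∀ δ : ℝ, 0 < δ → ∀ η : ℝ≥0∞, η ≠ 0 → ∃ K : Set X, IsCompact K ∧
      ∀ ν ∈ A, ν (Metric.thickening δ K)ᶜ ≤ η) : IsTightMeasureSet A := by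
  rw [isTightMeasureSet_iff_exists_isCompact_measure_compl_le]
  intro ε hε
  obtain ⟨η, hη0, hη⟩ := ENNReal.exists_pos_sum_of_countable' hε.ne' ℕ
  choose K hKc hK using fun n : ℕ => h (1 / ((n : ℝ) + 1)) (by positivity) (η n) (hη0 n).ne'
  refine ⟨_, isCompact_iInter_cthickening hKc, fun ν hν => ?_⟩
  rw [Set.compl_iInter]
  calc ν (⋃ n : ℕ, (Metric.cthickening (1 / ((n : ℝ) + 1)) (K n))ᶜ)
      ≤ ∑' n : ℕ, ν (Metric.cthickening (1 / ((n : ℝ) + 1)) (K n))ᶜ := measure_iUnion_le _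
    _ ≤ ∑' n, η n := ENNReal.tsum_le_tsum fun n => (measure_mono <| Set.compl_subset_compl.2 <|
        Metric.thickening_subset_cthickening _ _).trans (hK n ν hν)
    _ ≤ ε := hη.le

theorem lipschitzWith_mul_one_sub_thickenedIndicator {X : Type*} [PseudoMetricSpace X] {δ : ℝ}
    (hδ : 0 < δ) (K : Set X) :
    LipschitzWith 1 fun x => δ * (1 - (thickenedIndicator hδ K x : ℝ)) :=
  .of_dist_le_mul fun x y => by
    have hxy := (lipschitzWith_thickenedIndicator hδ K).dist_le_mul y x
    rw [NNReal.dist_eq, NNReal.coe_inv, Real.coe_toNNReal δ hδ.le, dist_comm,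
      le_inv_mul_iff₀ hδ] at hxy
    rw [NNReal.coe_one, one_mul, Real.dist_eq, ← mul_sub, sub_sub_sub_cancel_left, abs_mul,
      abs_of_pos hδ]
    exact hxy

variable {S : Type*} [PseudoMetricSpace S] [MeasurableSpace S] [OpensMeasurableSpace S]

theorem LipschitzL2Close.measure_compl_thickening_le {ε : ℝ≥0∞} {ν ρ : Measure S}
    (h : LipschitzL2Close ε ν ρ) {δ : ℝ} (hδ : 0 < δ) (K : Set S) :
    ENNReal.ofReal δ * ν (Metric.thickening δ K)ᶜ ^ (1 / 2 : ℝ) ≤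
      ENNReal.ofReal δ * ρ Kᶜ ^ (1 / 2 : ℝ) + ε := by
  let g : S → ℝ := fun x => δ * (1 - thickenedIndicator hδ K x)
  have hg0 : ∀ x ∈ K, g x = 0 := fun x hx => by
    simp only [g, thickenedIndicator_one hδ K hx, NNReal.coe_one, sub_self, mul_zero]
  have hg1 : ∀ x ∈ (Metric.thickening δ K)ᶜ, g x = δ := fun x hx => by
    simp only [g, thickenedIndicator_zero hδ K hx, NNReal.coe_zero, sub_zero, mul_one]
  have hg_nonneg : ∀ x, 0 ≤ g x := fun x =>
    mul_nonneg hδ.le (sub_nonneg.2 (mod_cast thickenedIndicator_le_one hδ K x))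
  have hg_le : ∀ x, g x ≤ δ := fun x =>
    mul_le_of_le_one_right hδ.le (sub_le_self _ NNReal.zero_le_coe)
  calc ENNReal.ofReal δ * ν (Metric.thickening δ K)ᶜ ^ (1 / 2 : ℝ)
      = eLpNorm ((Metric.thickening δ K)ᶜ.indicator fun _ => δ) 2 ν := by
        rw [eLpNorm_indicator_const Metric.isOpen_thickening.measurableSet.compl two_ne_zero
          ENNReal.ofNat_ne_top, Real.enorm_of_nonneg hδ.le, ENNReal.toReal_ofNat]
    _ ≤ eLpNorm g 2 ν := eLpNorm_mono_real fun x => by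
        by_cases hx : x ∈ (Metric.thickening δ K)ᶜ
        · rw [Set.indicator_of_mem hx, hg1 x hx, Real.norm_of_nonneg hδ.le]
        · rw [Set.indicator_of_notMem hx, norm_zero]
          exact hg_nonneg x
    _ ≤ eLpNorm g 2 ρ + ε := h g (lipschitzWith_mul_one_sub_thickenedIndicator hδ K)
    _ ≤ eLpNorm (Kᶜ.indicator fun _ => δ) 2 ρ + ε := by
        gcongr
        refine eLpNorm_mono_real fun x => ?_
        rw [Real.norm_of_nonneg (hg_nonneg x)]
        by_cases hx : x ∈ K
        · rw [Set.indicator_of_notMem (not_not_intro hx), hg0 x hx]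
        · rw [Set.indicator_of_mem (by exact hx)]
          exact hg_le x
    _ ≤ ENNReal.ofReal δ * ρ Kᶜ ^ (1 / 2 : ℝ) + ε := by
        gcongr
        simpa [Real.enorm_of_nonneg hδ.le] using
          eLpNorm_indicator_const_le (c := δ) (s := Kᶜ) (μ := ρ) 2

theorem isTightMeasureSet_of_lipschitzL2Close [CompleteSpace S] {A : Set (Measure S)}
    (h : ∀ ε : ℝ≥0∞, ε ≠ 0 → ∃ F, IsTightMeasureSet F ∧ ∀ ν ∈ A, ∃ ρ ∈ F,
      LipschitzL2Close ε ν ρ) : IsTightMeasureSet A := by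
  refine isTightMeasureSet_of_thickening fun δ hδ η hη => ?_
  have hδ' : ENNReal.ofReal δ ≠ 0 := by simpa using hδ
  set c := η ^ (1 / 2 : ℝ) / 2
  have hc : c ≠ 0 := by simp [c, hη]
  obtain ⟨F, hF, hAF⟩ := h (ENNReal.ofReal δ * c) (mul_ne_zero hδ' hc)
  obtain ⟨K, hK, hFK⟩ := isTightMeasureSet_iff_exists_isCompact_measure_compl_le.1 hF (c ^ 2)
    (ENNReal.pow_pos (pos_iff_ne_zero.2 hc) 2)
  refine ⟨K, hK, fun ν hν => ?_⟩
  obtain ⟨ρ, hρ, hνρ⟩ := hAF ν hν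
  have hρK : ρ Kᶜ ^ (1 / 2 : ℝ) ≤ c := by
    rw [one_div, ENNReal.rpow_inv_le_iff two_pos]
    exact_mod_cast hFK ρ hρ
  have hle : ENNReal.ofReal δ * ν (Metric.thickening δ K)ᶜ ^ (1 / 2 : ℝ) ≤
      ENNReal.ofReal δ * η ^ (1 / 2 : ℝ) :=
    calc _ ≤ ENNReal.ofReal δ * c + ENNReal.ofReal δ * c :=
          (hνρ.measure_compl_thickening_le hδ K).trans (by gcongr)
      _ = _ := by rw [← mul_add, ENNReal.add_halves]
  exact (ENNReal.rpow_le_rpow_iff one_half_pos).1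
    ((ENNReal.mul_le_mul_iff_right hδ' ENNReal.ofReal_ne_top).1 hle)

end Tightness

section FiniteSets

variable {S : Type*} [PseudoMetricSpace S] [MeasurableSpace S] [OpensMeasurableSpace S]

theorem lintegral_sq_edist_lt_top_of_tailNorm_ne_top {x₀ : S} {R : ℝ} {ν : Measure S}
    [IsFiniteMeasure ν] (h : tailNorm x₀ R ν ≠ ∞) : ∫⁻ x, edist x x₀ ^ 2 ∂ν < ∞ := by
  have hmem : MemLp (fun x => dist x x₀) 2 ν :=
    ((memLp_const R).add ⟨(lipschitzWith_radialExcess x₀ R).continuous.measurable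
      |>.aestronglyMeasurable, h.lt_top⟩).mono
      (by fun_prop : Continuous fun x => dist x x₀).measurable.aestronglyMeasurable <|
      Eventually.of_forall fun x => by
        rw [Real.norm_of_nonneg dist_nonneg]
        exact (dist_le_add_radialExcess x₀ R x).trans (le_abs_self _)
  have hedist : ∀ x, edist x x₀ = ‖dist x x₀‖ₑ := fun x => by
    rw [Real.enorm_of_nonneg dist_nonneg, edist_dist]
  simp only [hedist, ← sq_eLpNorm_two]
  exact ENNReal.pow_lt_top hmem.eLpNorm_lt_top

theorem unifSqIntegrable_singleton {x₀ : S} {ν : Measure S} (h : ∫⁻ x, edist x x₀ ^ 2 ∂ν ≠ ∞) :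
    UnifSqIntegrable x₀ {ν} := by
  have hlim : Tendsto (fun n : ℕ => tailNorm x₀ n ν ^ 2) atTop (𝓝 (∫⁻ _, 0 ∂ν)) := by
    simp only [tailNorm, sq_eLpNorm_two]
    refine tendsto_lintegral_of_dominated_convergence _ (fun n => ?_)
      (fun n => Eventually.of_forall fun x => ?_) h (Eventually.of_forall fun x => ?_)
    · exact (lipschitzWith_radialExcess x₀ n).continuous.measurable.enorm.pow_const 2
    · simp only [Real.enorm_of_nonneg (radialExcess_nonneg _ _ _), edist_dist]
      gcongr
      exact max_le (sub_le_self _ n.cast_nonneg) dist_nonneg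
    · refine tendsto_const_nhds.congr' ?_
      filter_upwards [tendsto_natCast_atTop_atTop.eventually_ge_atTop (dist x x₀)] with n hn
      simp [radialExcess, hn]
  rw [lintegral_zero] at hlim
  intro δ hδ
  obtain ⟨n, hn⟩ := (hlim.eventually
    (ge_mem_nhds (ENNReal.pow_pos (pos_iff_ne_zero.2 hδ) 2))).exists
  exact ⟨n, by simpa [ENNReal.pow_le_pow_left_iff two_ne_zero] using hn⟩

theorem unifSqIntegrable_of_finite {x₀ : S} {F : Set (Measure S)} (hF : F.Finite)
    (h : ∀ ν ∈ F, ∫⁻ x, edist x x₀ ^ 2 ∂ν ≠ ∞) : UnifSqIntegrable x₀ F := by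
  induction F, hF using Set.Finite.induction_on with
  | empty => exact fun δ _ => ⟨0, by simp⟩
  | insert _ _ ih =>
    rw [Set.insert_eq]
    exact (unifSqIntegrable_singleton (h _ (Set.mem_insert _ _))).union
      (ih fun ν hν => h ν (Set.mem_insert_of_mem _ hν))

end FiniteSets

theorem isTightMeasureSet_of_finite {S : Type*} [PseudoMetricSpace S] [CompleteSpace S]
    [SecondCountableTopology S] [MeasurableSpace S] [BorelSpace S] {F : Set (Measure S)}
    (hF : F.Finite) (h : ∀ ν ∈ F, IsFiniteMeasure ν) : IsTightMeasureSet F := by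
  induction F, hF using Set.Finite.induction_on with
  | empty =>
    exact isTightMeasureSet_iff_exists_isCompact_measure_compl_le.2
      fun _ _ => ⟨∅, isCompact_empty, by simp⟩
  | insert _ _ ih =>
    have := h _ (Set.mem_insert _ _)
    rw [Set.insert_eq]
    exact isTightMeasureSet_singleton.union (ih fun ν hν => h ν (Set.mem_insert_of_mem _ hν))

theorem isCompact_closure_of_subseq {X : Type*} [PseudoMetricSpace X] {A : Set X}
    (h : ∀ u : ℕ → X, (∀ n, u n ∈ A) →
      ∃ (a : X) (φ : ℕ → ℕ), StrictMono φ ∧ Tendsto (u ∘ φ) atTop (𝓝 a)) :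
    IsCompact (closure A) := by
  rw [isCompact_iff_isSeqCompact]
  intro x hx
  choose y hyA hxy using fun n => Metric.mem_closure_iff.1 (hx n) (1 / ((n : ℝ) + 1))
    (by positivity)
  obtain ⟨a, φ, hφ, ha⟩ := h y hyA
  have hdist : Tendsto (fun n => dist (x (φ n)) (y (φ n))) atTop (𝓝 0) :=
    squeeze_zero (fun _ => dist_nonneg) (fun n => (hxy (φ n)).le)
      (tendsto_one_div_add_atTop_nhds_zero_nat.comp hφ.tendsto_atTop)
  have hxa : Tendsto (x ∘ φ) atTop (𝓝 a) := (tendsto_iff_of_dist hdist).2 ha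
  exact ⟨a, isClosed_closure.mem_of_tendsto hxa (Eventually.of_forall fun n => hx _), φ, hφ, hxa⟩

theorem exists_strictMono_comp_strictMono_or_const (N : ℕ → ℕ) :
    ∃ g : ℕ → ℕ, StrictMono g ∧ (StrictMono (N ∘ g) ∨ ∃ c, ∀ n, N (g n) = c) := by
  obtain ⟨g, hg | hg⟩ := exists_increasing_or_nonincreasing_subseq (· < ·) N
  · exact ⟨g, g.strictMono, .inl fun m n hmn => hg m n hmn⟩
  · have hanti : Antitone (N ∘ g) :=
      antitone_nat_of_succ_le fun n => not_lt.1 (hg n _ n.lt_succ_self)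
    obtain ⟨m, hm⟩ := WellFoundedLT.antitone_chain_condition hanti
    exact ⟨fun n => g (m + n), fun a b hab => g.strictMono (by lia), .inr ⟨N (g m), fun n =>
      (hm (m + n) (by lia)).symm⟩⟩

theorem isCompact_closure_range_of_subseq {X : Type*} [PseudoMetricSpace X] {x : ℕ → X}
    (h : ∀ φ : ℕ → ℕ, StrictMono φ →
      ∃ (a : X) (ψ : ℕ → ℕ), StrictMono ψ ∧ Tendsto (x ∘ φ ∘ ψ) atTop (𝓝 a)) :
    IsCompact (closure (Set.range x)) := by
  refine isCompact_closure_of_subseq fun u hu => ?_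
  choose N hN using hu
  obtain rfl : x ∘ N = u := funext hN
  obtain ⟨g, hg, hmono | ⟨c, hc⟩⟩ := exists_strictMono_comp_strictMono_or_const N
  · obtain ⟨a, ψ, hψ, ha⟩ := h _ hmono
    exact ⟨a, g ∘ ψ, hg.comp hψ, ha⟩
  · exact ⟨x c, g, hg, tendsto_const_nhds.congr fun n => by simp [hc]⟩

namespace WassersteinSpace

variable {E : Type*} [NormedAddCommGroup E] [MeasurableSpace E]

/-- A point of `𝒫₂(E)` as a bundled probability measure, that is, as a point of the space carrying
the topology of weak convergence. -/
def toProbabilityMeasure (μ : WassersteinSpace E) : ProbabilityMeasure E :=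
  ⟨μ.toMeasure, μ.isProbabilityMeasure⟩

theorem lintegral_sq_edist_zero_ne_top (μ : WassersteinSpace E) :
    ∫⁻ x, edist x 0 ^ 2 ∂μ.toMeasure ≠ ∞ := by
  simpa only [edist_zero_right] using μ.lintegral_lt_top.ne

theorem lintegral_sq_enorm_sub_rpow_half (π : Measure (E × E)) :
    (∫⁻ z, ‖z.1 - z.2‖ₑ ^ 2 ∂π) ^ (1 / 2 : ℝ) = eLpNorm (fun z => dist z.1 z.2) 2 π := by
  simp [eLpNorm_two_eq_lintegral, dist_eq_norm]

theorem memLp_id [OpensMeasurableSpace E] [SecondCountableTopology E] (μ : WassersteinSpace E) :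
    MemLp id 2 μ.toMeasure := by
  refine ⟨measurable_id.aestronglyMeasurable, ?_⟩
  rw [← ENNReal.rpow_lt_top_iff_of_pos two_pos, ENNReal.rpow_two, sq_eLpNorm_two]
  exact μ.lintegral_lt_top

variable [BorelSpace E] [CompleteSpace E] [SecondCountableTopology E]

theorem edist_eq (μ ν : WassersteinSpace E) :
    edist μ ν = wassersteinTwo μ.toMeasure ν.toMeasure := by
  rw [edist_dist]
  exact ENNReal.ofReal_toReal (cost_ne_top μ ν)

theorem edist_le_of_mem_couplings {μ ν : WassersteinSpace E} {π : Measure (E × E)}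
    (hπ : π ∈ couplings μ.toMeasure ν.toMeasure) :
    edist μ ν ≤ eLpNorm (fun z => dist z.1 z.2) 2 π := by
  rw [edist_eq, ← lintegral_sq_enorm_sub_rpow_half]
  exact wassersteinTwo_le hπ

theorem lipschitzL2Close_edist (μ ν : WassersteinSpace E) :
    LipschitzL2Close (edist μ ν) μ.toMeasure ν.toMeasure := by
  intro g hg
  rw [edist_eq, ← tsub_le_iff_left]
  refine le_wassersteinTwo fun π hπ => ?_
  rw [lintegral_sq_enorm_sub_rpow_half, tsub_le_iff_left]
  exact lipschitzL2Close_of_mem_couplings hπ g hg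

theorem tendsto_of_tendsto_toProbabilityMeasure {u : ℕ → WassersteinSpace E}
    {μ : WassersteinSpace E}
    (h : Tendsto (fun n => (u n).toProbabilityMeasure) atTop (𝓝 μ.toProbabilityMeasure))
    (hU : UnifSqIntegrable 0 (Set.range fun n => (u n).toMeasure)) :
    Tendsto u atTop (𝓝 μ) := by
  rw [EMetric.tendsto_nhds]
  intro ε hε
  obtain ⟨e, he0, heε⟩ := exists_between hε
  filter_upwards [eventually_exists_coupling_cost_le h hU he0.ne'] with n ⟨π, hπ, hcost⟩
  rw [edist_comm]
  exact (edist_le_of_mem_couplings hπ).trans_lt (hcost.trans_lt heε)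

theorem isCompact_closure_of_isTightMeasureSet {A : Set (WassersteinSpace E)}
    (ht : IsTightMeasureSet (toMeasure '' A)) (hU : UnifSqIntegrable 0 (toMeasure '' A)) :
    IsCompact (closure A) := by
  refine isCompact_closure_of_subseq fun u hu => ?_
  have hcomp : IsCompact (closure (toProbabilityMeasure '' A)) := by
    refine _root_.isCompact_closure_of_isTightMeasureSet (ht.subset ?_)
    rintro _ ⟨_, ⟨μ, hμ, rfl⟩, rfl⟩
    exact ⟨μ, hμ, rfl⟩
  obtain ⟨μ, -, φ, hφ, hlim⟩ := hcomp.tendsto_subseq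
    (x := fun n => (u n).toProbabilityMeasure) fun n => subset_closure ⟨_, hu n, rfl⟩
  have hUφ : UnifSqIntegrable 0 (Set.range fun n => (u (φ n)).toMeasure) :=
    hU.mono (Set.range_subset_iff.2 fun n => ⟨_, hu _, rfl⟩)
  have hfin : ∫⁻ x, ‖x‖ₑ ^ 2 ∂(μ : Measure E) < ∞ := by
    obtain ⟨R, hR⟩ := hUφ 1 one_ne_zero
    have htail : tailNorm 0 R (μ : Measure E) ≤ 1 := eLpNorm_le_of_tendsto hlim
      (lipschitzWith_radialExcess 0 R).continuous fun n => hR _ ⟨n, rfl⟩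
    simpa only [edist_zero_right] using
      lintegral_sq_edist_lt_top_of_tailNorm_ne_top (ne_top_of_le_ne_top ENNReal.one_ne_top htail)
  exact ⟨⟨μ, inferInstance, hfin⟩, φ, hφ, tendsto_of_tendsto_toProbabilityMeasure hlim hUφ⟩

theorem isTightMeasureSet_and_unifSqIntegrable_of_finite_net {A : Set (Measure E)}
    (h : ∀ ε : ℝ≥0∞, ε ≠ 0 → ∃ F : Set (WassersteinSpace E), F.Finite ∧
      ∀ ν ∈ A, ∃ ρ ∈ F, LipschitzL2Close ε ν ρ.toMeasure) :
    IsTightMeasureSet A ∧ UnifSqIntegrable 0 A := by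
  refine ⟨isTightMeasureSet_of_lipschitzL2Close fun ε hε => ?_,
    .of_lipschitzL2Close fun ε hε => ?_⟩ <;> obtain ⟨F, hF, hAF⟩ := h ε hε
  · refine ⟨toMeasure '' F, isTightMeasureSet_of_finite (hF.image _) ?_, fun ν hν => ?_⟩
    · rintro _ ⟨ρ, -, rfl⟩
      infer_instance
    · simpa using hAF ν hν
  · refine ⟨toMeasure '' F, unifSqIntegrable_of_finite (hF.image _) ?_, fun ν hν => ?_⟩
    · rintro _ ⟨ρ, -, rfl⟩
      exact ρ.lintegral_sq_edist_zero_ne_top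
    · simpa using hAF ν hν

theorem isTightMeasureSet_and_unifSqIntegrable_of_totallyBounded {A : Set (WassersteinSpace E)}
    (hA : TotallyBounded A) :
    IsTightMeasureSet (toMeasure '' A) ∧ UnifSqIntegrable 0 (toMeasure '' A) := by
  refine isTightMeasureSet_and_unifSqIntegrable_of_finite_net fun ε hε => ?_
  obtain ⟨F, hF, hAF⟩ := EMetric.totallyBounded_iff.1 hA ε (pos_iff_ne_zero.2 hε)
  refine ⟨F, hF, Set.forall_mem_image.2 fun ν hν => ?_⟩
  obtain ⟨ρ, hρ, hνρ⟩ := Set.mem_iUnion₂.1 (hAF hν)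
  exact ⟨ρ, hρ, (lipschitzL2Close_edist ν ρ).mono hνρ.le⟩

instance instCompleteSpace : CompleteSpace (WassersteinSpace E) := by
  refine Metric.complete_of_cauchySeq_tendsto fun u hu => ?_
  obtain ⟨ht, hU⟩ :=
    isTightMeasureSet_and_unifSqIntegrable_of_totallyBounded hu.totallyBounded_range
  obtain ⟨a, -, φ, hφ, ha⟩ := (isCompact_closure_of_isTightMeasureSet ht hU).tendsto_subseq
    fun n => subset_closure (Set.mem_range_self n)
  exact ⟨a, tendsto_nhds_of_cauchySeq_of_subseq hu hφ.tendsto_atTop ha⟩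

theorem isCompact_closure_setOf_measure_compl_eq_zero {K : Set E} (hK : IsCompact K) :
    IsCompact (closure {μ : WassersteinSpace E | μ.toMeasure Kᶜ = 0}) := by
  refine isCompact_closure_of_isTightMeasureSet ?_ fun δ _ => ?_
  · rw [isTightMeasureSet_iff_exists_isCompact_measure_compl_le]
    refine fun ε _ => ⟨K, hK, Set.forall_mem_image.2 fun μ hμ => ?_⟩
    exact (show μ.toMeasure Kᶜ = 0 from hμ).trans_le zero_le
  · obtain ⟨R, hR⟩ := hK.isBounded.subset_closedBall 0
    refine ⟨R, Set.forall_mem_image.2 fun μ hμ => ?_⟩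
    have h0 : radialExcess 0 R =ᵐ[μ.toMeasure] 0 := by
      filter_upwards [compl_mem_ae_iff.2 hμ] with x hx
      exact max_eq_right (sub_nonpos.2 (hR (not_not.1 hx)))
    rw [tailNorm, eLpNorm_congr_ae h0, eLpNorm_zero]
    exact zero_le

/-- The image of a point of `𝒫₂(E)` under a square-integrable map. -/
noncomputable def pushforward {F : Type*} [NormedAddCommGroup F] [MeasurableSpace F] [BorelSpace F]
    (μ : WassersteinSpace E) {T : E → F} (hT : Measurable T) (hT2 : MemLp T 2 μ.toMeasure) :
    WassersteinSpace F where
  toMeasure := μ.toMeasure.map T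
  isProbabilityMeasure := Measure.isProbabilityMeasure_map hT.aemeasurable
  lintegral_lt_top := by
    rw [lintegral_map (by fun_prop) hT, ← sq_eLpNorm_two]
    exact ENNReal.pow_lt_top hT2.eLpNorm_lt_top

theorem edist_pushforward_le (μ : WassersteinSpace E) {T : E → E} (hT : Measurable T)
    (hT2 : MemLp T 2 μ.toMeasure) :
    edist (μ.pushforward hT hT2) μ ≤ eLpNorm (T - id) 2 μ.toMeasure := by
  have hm : Measurable fun x => (T x, x) := hT.prodMk measurable_id
  have hπ : μ.toMeasure.map (fun x => (T x, x)) ∈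
      couplings (μ.pushforward hT hT2).toMeasure μ.toMeasure := by
    refine ⟨Measure.isProbabilityMeasure_map hm.aemeasurable, ?_, ?_⟩
    · rw [Measure.fst, Measure.map_map measurable_fst hm]
      rfl
    · rw [Measure.snd, Measure.map_map measurable_snd hm]
      exact Measure.map_id
  refine (edist_le_of_mem_couplings hπ).trans ?_
  rw [eLpNorm_map_measure continuous_dist.measurable.aestronglyMeasurable hm.aemeasurable]
  exact eLpNorm_mono fun x => by simp [dist_eq_norm]

instance instSecondCountableTopology : SecondCountableTopology (WassersteinSpace E) := by
  let T : ℕ → SimpleFunc E E := SimpleFunc.approxOn id measurable_id Set.univ 0 (Set.mem_univ 0)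
  have hsep : TopologicalSpace.IsSeparable
      (⋃ n, {ν : WassersteinSpace E | ν.toMeasure (Set.range (T n))ᶜ = 0}) := .iUnion fun n =>
    (isCompact_closure_setOf_measure_compl_eq_zero
      (T n).finite_range.isCompact).isSeparable.mono subset_closure
  suffices TopologicalSpace.SeparableSpace (WassersteinSpace E) from
    UniformSpace.secondCountable_of_separable _
  rw [← TopologicalSpace.isSeparable_univ_iff]
  refine hsep.closure.mono fun μ _ => ?_
  have hT2 : ∀ n, MemLp (T n) 2 μ.toMeasure :=
    SimpleFunc.memLp_approxOn measurable_id μ.memLp_id (Set.mem_univ 0) (by simp)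
  have hTsub : Tendsto (fun n => eLpNorm (⇑(T n) - id) 2 μ.toMeasure) atTop (𝓝 0) :=
    SimpleFunc.tendsto_approxOn_Lp_eLpNorm measurable_id _ ENNReal.ofNat_ne_top (by simp)
      (by simpa only [sub_zero] using μ.memLp_id.eLpNorm_lt_top)
  have hlim : Tendsto (fun n => μ.pushforward (T n).measurable (hT2 n)) atTop (𝓝 μ) :=
    tendsto_iff_edist_tendsto_0.2 <| tendsto_of_tendsto_of_tendsto_of_le_of_le tendsto_const_nhds
      hTsub (fun _ => zero_le) fun n => μ.edist_pushforward_le _ _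
  refine mem_closure_of_tendsto hlim (Eventually.of_forall fun n => Set.mem_iUnion.2 ⟨n, ?_⟩)
  change (μ.toMeasure.map (T n)) _ = 0
  rw [Measure.map_apply (T n).measurable (T n).finite_range.measurableSet.compl,
    Set.preimage_compl, Set.preimage_range, Set.compl_univ, measure_empty]

end WassersteinSpace

section Skorokhod

theorem exists_unitInterval_realisation {ι S T : Type*} [MeasurableSpace S] [StandardBorelSpace S]
    [Nonempty S] [MeasurableSpace T] [StandardBorelSpace T] [Nonempty T] {L : Measure S}
    [IsProbabilityMeasure L] {γ : ι → Measure (S × T)} [∀ i, IsFiniteMeasure (γ i)]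
    (hγ : ∀ i, (γ i).fst = L) :
    ∃ (X : unitInterval × unitInterval → S) (Y : ι → unitInterval × unitInterval → T),
      Measurable X ∧ (∀ i, Measurable (Y i)) ∧ ∀ i, volume.map (fun ω => (X ω, Y i ω)) = γ i := by
  obtain ⟨g, hg, hgL⟩ := Measure.exists_measurable_map_eq L
  choose f hf hfγ using fun i => Kernel.exists_measurable_map_eq_unitInterval (γ i).condKernel
  have hX : Measurable fun ω : unitInterval × unitInterval => g ω.1 := hg.comp measurable_fst
  have hY : ∀ i, Measurable fun ω : unitInterval × unitInterval => f i (g ω.1) ω.2 :=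
    fun i => (hf i).comp (hX.prodMk measurable_snd)
  refine ⟨_, _, hX, hY, fun i => Measure.ext_of_lintegral _ fun h hh => ?_⟩
  have hm := hX.prodMk (hY i)
  have hslice : ∀ x, ∫⁻ v, h (x, f i x v) = ∫⁻ y, h (x, y) ∂(γ i).condKernel x := fun x => by
    rw [← hfγ i x, lintegral_map (by fun_prop) (hf i).of_uncurry_left]
  calc ∫⁻ z, h z ∂volume.map (fun ω : unitInterval × unitInterval => (g ω.1, f i (g ω.1) ω.2))
      = ∫⁻ u, ∫⁻ v, h (g u, f i (g u) v) := by
        rw [lintegral_map hh hm, Measure.volume_eq_prod,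
          lintegral_prod (fun ω : unitInterval × unitInterval => h (g ω.1, f i (g ω.1) ω.2))
            (hh.comp hm).aemeasurable]
    _ = ∫⁻ u, ∫⁻ y, h (g u, y) ∂(γ i).condKernel (g u) := by simp only [hslice]
    _ = ∫⁻ x, ∫⁻ y, h (x, y) ∂(γ i).condKernel x ∂(γ i).fst := by
        rw [hγ i, ← hgL, lintegral_map hh.lintegral_kernel_prod_right' hg]
    _ = ∫⁻ z, h z ∂γ i := by
        rw [← Measure.lintegral_compProd hh, (γ i).disintegrate (γ i).condKernel]

theorem exists_realisation_of_fst_eq {ι S T : Type*} [MeasurableSpace S] [StandardBorelSpace S]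
    [Nonempty S] [MeasurableSpace T] [StandardBorelSpace T] [Nonempty T] {L : Measure S}
    [IsProbabilityMeasure L] {γ : ι → Measure (S × T)} [∀ i, IsFiniteMeasure (γ i)]
    (hγ : ∀ i, (γ i).fst = L) :
    ∃ (Ω' : Type w) (_ : MeasurableSpace Ω') (P' : Measure Ω') (X : Ω' → S) (Y : ι → Ω' → T),
      IsProbabilityMeasure P' ∧ Measurable X ∧ (∀ i, Measurable (Y i)) ∧
      ∀ i, P'.map (fun ω => (X ω, Y i ω)) = γ i := by
  obtain ⟨X, Y, hX, hY, hXY⟩ := exists_unitInterval_realisation hγ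
  let e := MeasurableEquiv.ulift.{0, w} (α := unitInterval × unitInterval)
  refine ⟨ULift.{w} (unitInterval × unitInterval), inferInstance, volume.map e.symm, X ∘ e,
    fun i => Y i ∘ e, Measure.isProbabilityMeasure_map e.symm.measurable.aemeasurable,
    hX.comp e.measurable, fun i => (hY i).comp e.measurable, fun i => ?_⟩
  rw [Measure.map_map ((hX.comp e.measurable).prodMk ((hY i).comp e.measurable))
    e.symm.measurable, ← hXY i]
  rfl

variable {S : Type*} [MetricSpace S] [CompleteSpace S] [SecondCountableTopology S]
  [MeasurableSpace S] [BorelSpace S]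

theorem exists_skorokhod_representation_of_tendsto {x₀ : S} {L : ℕ → ProbabilityMeasure S}
    {Llim : ProbabilityMeasure S} (hL : Tendsto L atTop (𝓝 Llim))
    (hU : UnifSqIntegrable x₀ (Set.range fun n => (L n : Measure S))) :
    ∃ ψ : ℕ → ℕ, StrictMono ψ ∧
      ∃ (Ω' : Type w) (_ : MeasurableSpace Ω') (P' : Measure Ω') (Y : ℕ → Ω' → S) (X : Ω' → S),
        IsProbabilityMeasure P' ∧ (∀ k, Measurable (Y k)) ∧ Measurable X ∧
        (∀ k, P'.map (Y k) = L (ψ k)) ∧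
        (∀ᵐ ω ∂P', Tendsto (fun k => dist (Y k ω) (X ω)) atTop (𝓝 0)) ∧
        (∀ k, MemLp (fun ω => dist (Y k ω) (X ω)) 2 P') ∧
        Tendsto (fun k => eLpNorm (fun ω => dist (Y k ω) (X ω)) 2 P') atTop (𝓝 0) := by
  have : Nonempty S := ⟨x₀⟩
  obtain ⟨ψ, hψ, hγ⟩ := extraction_forall_of_eventually fun k : ℕ =>
    eventually_exists_coupling_cost_le hL hU (ε := 2⁻¹ ^ k) (by simp)
  choose γ hγmem hγcost using hγ
  have : ∀ k, IsProbabilityMeasure (γ k) := fun k => (hγmem k).1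
  obtain ⟨Ω', mΩ', P', X, Y, hP', hX, hY, hlaw⟩ :=
    exists_realisation_of_fst_eq.{w} fun k => (hγmem k).2.1
  have hcost : ∀ k, eLpNorm (fun ω => dist (Y k ω) (X ω)) 2 P' ≤ 2⁻¹ ^ k := fun k => by
    have h := hγcost k
    rw [← hlaw k, eLpNorm_map_measure (by fun_prop) (hX.prodMk (hY k)).aemeasurable] at h
    simpa only [Function.comp_def, dist_comm] using h
  have hdist : ∀ k, AEStronglyMeasurable (fun ω => dist (Y k ω) (X ω)) P' :=
    fun k => ((hY k).dist hX).aestronglyMeasurable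
  refine ⟨ψ, hψ, Ω', mΩ', P', Y, X, hP', hY, hX, fun k => ?_, ?_,
    fun k => ⟨hdist k, (hcost k).trans_lt (by finiteness)⟩, ?_⟩
  · rw [← (hγmem k).2.2, ← hlaw k, Measure.snd,
      Measure.map_map measurable_snd (hX.prodMk (hY k))]
    rfl
  · have hsum : ∑' k, eLpNorm (fun ω => dist (Y k ω) (X ω)) 2 P' ≠ ∞ :=
      ne_top_of_le_ne_top (by simp [ENNReal.tsum_geometric]) (ENNReal.tsum_le_tsum hcost)
    filter_upwards [summable_norm_of_tsum_eLpNorm_ne_top one_le_two hdist hsum] with ω hω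
    exact tendsto_zero_iff_norm_tendsto_zero.2 hω.tendsto_atTop_zero
  · exact tendsto_of_tendsto_of_tendsto_of_le_of_le tendsto_const_nhds
      (ENNReal.tendsto_pow_atTop_nhds_zero_of_lt_one (by simp)) (fun _ => zero_le) hcost

theorem exists_skorokhod_representation {x₀ : S} {L : ℕ → Measure S}
    (hprob : ∀ n, IsProbabilityMeasure (L n)) (ht : IsTightMeasureSet (Set.range L))
    (hU : UnifSqIntegrable x₀ (Set.range L)) :
    ∃ ψ : ℕ → ℕ, StrictMono ψ ∧
      ∃ (Ω' : Type w) (_ : MeasurableSpace Ω') (P' : Measure Ω') (Y : ℕ → Ω' → S) (X : Ω' → S),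
        IsProbabilityMeasure P' ∧ (∀ k, Measurable (Y k)) ∧ Measurable X ∧
        (∀ k, P'.map (Y k) = L (ψ k)) ∧
        (∀ᵐ ω ∂P', Tendsto (fun k => dist (Y k ω) (X ω)) atTop (𝓝 0)) ∧
        (∀ k, MemLp (fun ω => dist (Y k ω) (X ω)) 2 P') ∧
        Tendsto (fun k => eLpNorm (fun ω => dist (Y k ω) (X ω)) 2 P') atTop (𝓝 0) := by
  let L' : ℕ → ProbabilityMeasure S := fun n => ⟨L n, hprob n⟩
  have hcomp : IsCompact (closure (Set.range L')) := by
    refine isCompact_closure_of_isTightMeasureSet (ht.subset ?_)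
    rintro _ ⟨_, ⟨n, rfl⟩, rfl⟩
    exact ⟨n, rfl⟩
  obtain ⟨Llim, -, θ, hθ, hlim⟩ :=
    hcomp.tendsto_subseq fun n => subset_closure (Set.mem_range_self n)
  obtain ⟨ψ, hψ, h⟩ := exists_skorokhod_representation_of_tendsto hlim
    (hU.mono (Set.range_subset_iff.2 fun n => ⟨θ n, rfl⟩))
  exact ⟨θ ∘ ψ, hθ.comp hψ, h⟩

end Skorokhod

section RandomMeasure

theorem measure_setOf_exists_lt_le_tsum {Ω : Type*} [MeasurableSpace Ω] {P : Measure Ω}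
    {H : ℕ → Ω → ℝ≥0∞} (hH : ∀ j, AEMeasurable (H j) P) {a : ℕ → ℝ≥0∞} (ha0 : ∀ j, a j ≠ 0)
    (hat : ∀ j, a j ≠ ∞) : P {ω | ∃ j, a j < H j ω} ≤ ∑' j, (∫⁻ ω, H j ω ∂P) / a j := by
  rw [Set.ofPred_exists]
  refine (measure_iUnion_le _).trans (ENNReal.tsum_le_tsum fun j => ?_)
  have hsub : {ω | a j < H j ω} ⊆ {ω | a j ≤ H j ω} :=
    Set.ofPred_subset_ofPred.2 fun _ => le_of_lt
  exact (measure_mono hsub).trans (meas_ge_le_lintegral_div (hH j) (ha0 j) (hat j))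

variable {E : Type*} [NormedAddCommGroup E] [MeasurableSpace E] [BorelSpace E] [CompleteSpace E]
  [SecondCountableTopology E]

namespace WassersteinSpace

theorem measurable_eLpNorm_two {F : Type*} [NormedAddCommGroup F] [MeasurableSpace F]
    [OpensMeasurableSpace F] {g : E → F} (hg : Measurable g) :
    Measurable fun m : WassersteinSpace E => eLpNorm g 2 m.toMeasure := by
  simp only [eLpNorm_two_eq_lintegral]
  exact ((Measure.measurable_lintegral (by fun_prop)).comp measurable_toMeasure).pow_const _

theorem measurable_measure_add_tailNorm {s : Set E} (hs : MeasurableSet s) (x₀ : E) (R : ℝ) :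
    Measurable fun m : WassersteinSpace E => m.toMeasure s + tailNorm x₀ R m.toMeasure :=
  ((Measure.measurable_coe hs).comp measurable_toMeasure).add
    (measurable_eLpNorm_two (lipschitzWith_radialExcess x₀ R).continuous.measurable)

theorem isCompact_closure_setOf_forall_add_le {K : ℕ → Set E} (hK : ∀ j, IsCompact (K j))
    (R : ℕ → ℝ) {a : ℕ → ℝ≥0∞} (ha : Tendsto a atTop (𝓝 0)) :
    IsCompact (closure {m : WassersteinSpace E |
      ∀ j, m.toMeasure (K j)ᶜ + tailNorm 0 (R j) m.toMeasure ≤ a j}) := by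
  have hsmall : ∀ δ : ℝ≥0∞, δ ≠ 0 → ∃ j, a j ≤ δ := fun δ hδ =>
    (ha.eventually (ge_mem_nhds (pos_iff_ne_zero.2 hδ))).exists
  refine isCompact_closure_of_isTightMeasureSet ?_ fun δ hδ => ?_
  · rw [isTightMeasureSet_iff_exists_isCompact_measure_compl_le]
    intro δ hδ
    obtain ⟨j, hj⟩ := hsmall δ hδ.ne'
    exact ⟨K j, hK j, Set.forall_mem_image.2 fun m hm => le_self_add.trans ((hm j).trans hj)⟩
  · obtain ⟨j, hj⟩ := hsmall δ hδ
    exact ⟨R j, Set.forall_mem_image.2 fun m hm => le_add_self.trans ((hm j).trans hj)⟩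

/-- The Dirac mass at the origin, the base point with respect to which uniform square integrability
of the laws of random measures is tested. -/
noncomputable def diracZero : WassersteinSpace E :=
  ⟨Measure.dirac 0, inferInstance, by simp⟩

theorem edist_diracZero_le (m : WassersteinSpace E) :
    edist m diracZero ≤ eLpNorm id 2 m.toMeasure := by
  have h : m.pushforward measurable_const (memLp_const (0 : E)) = diracZero :=
    WassersteinSpace.ext (by simp [pushforward, diracZero, Measure.map_const])
  rw [edist_comm, ← h]
  refine (m.edist_pushforward_le _ _).trans (eLpNorm_mono fun x => ?_)
  simp

theorem enorm_radialExcess_diracZero_le {R : ℝ} (hR : 0 ≤ R) (m : WassersteinSpace E) :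
    ‖radialExcess diracZero R m‖ₑ ≤ tailNorm 0 R m.toMeasure := by
  have hnorm : eLpNorm id 2 m.toMeasure ≤ ENNReal.ofReal R + tailNorm 0 R m.toMeasure := calc
    eLpNorm id 2 m.toMeasure ≤ eLpNorm ((fun _ => R) + radialExcess 0 R) 2 m.toMeasure :=
        eLpNorm_mono_real fun x => by simpa using dist_le_add_radialExcess 0 R x
    _ ≤ eLpNorm (fun _ => R) 2 m.toMeasure + tailNorm 0 R m.toMeasure :=
        eLpNorm_add_le aestronglyMeasurable_const
          (lipschitzWith_radialExcess 0 R).continuous.measurable.aestronglyMeasurable one_le_two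
    _ = ENNReal.ofReal R + tailNorm 0 R m.toMeasure := by
        rw [eLpNorm_const _ two_ne_zero (NeZero.ne _), measure_univ, ENNReal.one_rpow, mul_one,
          Real.enorm_of_nonneg hR]
  rw [Real.enorm_of_nonneg (radialExcess_nonneg _ _ _), radialExcess,
    ENNReal.ofReal_max, ENNReal.ofReal_zero, max_eq_left zero_le, ENNReal.ofReal_sub _ hR,
    ← edist_dist]
  exact tsub_le_iff_left.2 (m.edist_diracZero_le.trans hnorm)

end WassersteinSpace

variable {Ω : Type*} [MeasurableSpace Ω] {P : Measure Ω}

theorem intensity_eq_bind_map {μ : Ω → WassersteinSpace E} (hμ : Measurable μ) :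
    intensity P μ = (P.map μ).bind WassersteinSpace.toMeasure := by
  rw [intensity, Measure.bind, Measure.bind,
    Measure.map_map WassersteinSpace.measurable_toMeasure hμ]
  rfl

theorem intensity_apply {μ : Ω → WassersteinSpace E} (hμ : Measurable μ) {s : Set E}
    (hs : MeasurableSet s) : intensity P μ s = ∫⁻ ω, (μ ω).toMeasure s ∂P :=
  Measure.bind_apply hs (WassersteinSpace.measurable_toMeasure.comp hμ).aemeasurable

theorem eLpNorm_two_intensity {F : Type*} [NormedAddCommGroup F] [MeasurableSpace F]
    [OpensMeasurableSpace F] {μ : Ω → WassersteinSpace E} (hμ : Measurable μ) {g : E → F}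
    (hg : Measurable g) :
    eLpNorm g 2 (intensity P μ) = eLpNorm (fun ω => eLpNorm g 2 (μ ω).toMeasure) 2 P := by
  simp only [eLpNorm_two_eq_lintegral _ P, enorm_eq_self, sq_eLpNorm_two]
  rw [eLpNorm_two_eq_lintegral, lintegral_intensity P hμ (by fun_prop)]

theorem tailNorm_intensity {μ : Ω → WassersteinSpace E} (hμ : Measurable μ) (x₀ : E) (R : ℝ) :
    tailNorm x₀ R (intensity P μ) = eLpNorm (fun ω => tailNorm x₀ R (μ ω).toMeasure) 2 P :=
  eLpNorm_two_intensity hμ (lipschitzWith_radialExcess x₀ R).continuous.measurable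

theorem lipschitzL2Close_intensity {μ ν : Ω → WassersteinSpace E} (hμ : Measurable μ)
    (hν : Measurable ν) :
    LipschitzL2Close (eLpNorm (fun ω => dist (μ ω) (ν ω)) 2 P) (intensity P μ)
      (intensity P ν) := by
  intro g hg
  have hgm : Measurable g := hg.continuous.measurable
  calc eLpNorm g 2 (intensity P μ)
      ≤ eLpNorm ((fun ω => eLpNorm g 2 (ν ω).toMeasure) + fun ω => edist (μ ω) (ν ω)) 2 P := by
        rw [eLpNorm_two_intensity hμ hgm]
        exact eLpNorm_mono_enorm fun ω => (μ ω).lipschitzL2Close_edist (ν ω) g hg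
    _ ≤ eLpNorm (fun ω => eLpNorm g 2 (ν ω).toMeasure) 2 P
          + eLpNorm (fun ω => edist (μ ω) (ν ω)) 2 P :=
        eLpNorm_add_le
          ((WassersteinSpace.measurable_eLpNorm_two hgm).comp hν).aestronglyMeasurable
          (hμ.edist hν).aestronglyMeasurable one_le_two
    _ = eLpNorm g 2 (intensity P ν) + eLpNorm (fun ω => dist (μ ω) (ν ω)) 2 P := by
        rw [eLpNorm_two_intensity hν hgm]
        congr 1
        refine eLpNorm_congr_enorm_ae (.of_forall fun ω => ?_)
        rw [Real.enorm_of_nonneg dist_nonneg, ← edist_dist, enorm_eq_self]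

variable {ι : Type*} {μ : ι → Ω → WassersteinSpace E}

theorem unifSqIntegrable_range_map (hμ : ∀ i, Measurable (μ i))
    (hU : UnifSqIntegrable 0 (Set.range fun i => intensity P (μ i))) :
    UnifSqIntegrable WassersteinSpace.diracZero (Set.range fun i => P.map (μ i)) := by
  intro δ hδ
  obtain ⟨R, hR0, hR⟩ := hU.exists_nonneg hδ
  refine ⟨R, Set.forall_mem_range.2 fun i => ?_⟩
  calc tailNorm WassersteinSpace.diracZero R (P.map (μ i))
      = eLpNorm (fun ω => radialExcess WassersteinSpace.diracZero R (μ i ω)) 2 P :=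
        eLpNorm_map_measure
          (lipschitzWith_radialExcess _ R).continuous.measurable.aestronglyMeasurable
          (hμ i).aemeasurable
    _ ≤ eLpNorm (fun ω => tailNorm 0 R (μ i ω).toMeasure) 2 P :=
        eLpNorm_mono_enorm fun ω => (μ i ω).enorm_radialExcess_diracZero_le hR0
    _ = tailNorm 0 R (intensity P (μ i)) := (tailNorm_intensity (hμ i) 0 R).symm
    _ ≤ δ := hR _ ⟨i, rfl⟩

variable [IsProbabilityMeasure P]

theorem lintegral_measure_add_tailNorm_le {μ : Ω → WassersteinSpace E} (hμ : Measurable μ)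
    {s : Set E} (hs : MeasurableSet s) (x₀ : E) (R : ℝ) :
    ∫⁻ ω, ((μ ω).toMeasure s + tailNorm x₀ R (μ ω).toMeasure) ∂P ≤
      intensity P μ s + tailNorm x₀ R (intensity P μ) := by
  have hsm : Measurable fun ω => (μ ω).toMeasure s :=
    ((Measure.measurable_coe hs).comp WassersteinSpace.measurable_toMeasure).comp hμ
  have htm : Measurable fun ω => tailNorm x₀ R (μ ω).toMeasure :=
    (WassersteinSpace.measurable_eLpNorm_two
      (lipschitzWith_radialExcess x₀ R).continuous.measurable).comp hμ
  rw [lintegral_add_left hsm, ← intensity_apply hμ hs, tailNorm_intensity hμ]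
  gcongr
  simpa only [eLpNorm_one_eq_lintegral_enorm, enorm_eq_self] using
    eLpNorm_le_eLpNorm_of_exponent_le (one_le_two (α := ℝ≥0∞)) htm.aestronglyMeasurable

theorem isTightMeasureSet_range_map (hμ : ∀ i, Measurable (μ i))
    (ht : IsTightMeasureSet (Set.range fun i => intensity P (μ i)))
    (hU : UnifSqIntegrable 0 (Set.range fun i => intensity P (μ i))) :
    IsTightMeasureSet (Set.range fun i => P.map (μ i)) := by
  rw [isTightMeasureSet_iff_exists_isCompact_measure_compl_le] at ht ⊢
  intro ε hε
  obtain ⟨η, hη0, hη⟩ := ENNReal.exists_pos_sum_of_countable' hε.ne' ℕ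
  let a : ℕ → ℝ≥0∞ := fun j => 2⁻¹ ^ j
  have ha0 : ∀ j, a j ≠ 0 := fun j => by simp [a]
  have hat : ∀ j, a j ≠ ∞ := fun j => by simp [a]
  have ha : Tendsto a atTop (𝓝 0) := ENNReal.tendsto_pow_atTop_nhds_zero_of_lt_one (by simp)
  have hhalf : ∀ j, η j * a j / 2 ≠ 0 := fun j => by simp [(hη0 j).ne', ha0 j]
  choose K hKc hK using fun j => ht (η j * a j / 2) (pos_iff_ne_zero.2 (hhalf j))
  choose R hR using fun j => hU (η j * a j / 2) (hhalf j)
  let H : ℕ → WassersteinSpace E → ℝ≥0∞ := fun j m =>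
    m.toMeasure (K j)ᶜ + tailNorm 0 (R j) m.toMeasure
  have hHm : ∀ j, Measurable (H j) := fun j =>
    WassersteinSpace.measurable_measure_add_tailNorm (hKc j).measurableSet.compl 0 (R j)
  have hHint : ∀ j i, ∫⁻ ω, H j (μ i ω) ∂P ≤ η j * a j := fun j i => calc
    ∫⁻ ω, H j (μ i ω) ∂P
      ≤ intensity P (μ i) (K j)ᶜ + tailNorm 0 (R j) (intensity P (μ i)) :=
        lintegral_measure_add_tailNorm_le (hμ i) (hKc j).measurableSet.compl 0 (R j)
    _ ≤ η j * a j / 2 + η j * a j / 2 := add_le_add (hK j _ ⟨i, rfl⟩) (hR j _ ⟨i, rfl⟩)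
    _ = η j * a j := ENNReal.add_halves _
  have hA := WassersteinSpace.isCompact_closure_setOf_forall_add_le hKc R ha
  refine ⟨_, hA, Set.forall_mem_range.2 fun i => ?_⟩
  rw [Measure.map_apply (hμ i) hA.measurableSet.compl]
  calc P (μ i ⁻¹' (closure {m | ∀ j, H j m ≤ a j})ᶜ)
      ≤ P {ω | ∃ j, a j < H j (μ i ω)} := measure_mono fun ω hω => by
        simpa using fun h => hω (subset_closure h)
    _ ≤ ∑' j, (∫⁻ ω, H j (μ i ω) ∂P) / a j :=
        measure_setOf_exists_lt_le_tsum (fun j => ((hHm j).comp (hμ i)).aemeasurable) ha0 hat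
    _ ≤ ∑' j, η j := ENNReal.tsum_le_tsum fun j => ENNReal.div_le_of_le_mul (hHint j i)
    _ ≤ ε := hη.le

theorem isCompact_closure_range_intensityPoint_of_tendsto {μ : ℕ → Ω → WassersteinSpace E}
    {ν : Ω → WassersteinSpace E} (hμ : ∀ k, Measurable (μ k)) (hν : Measurable ν)
    (hI : ∀ k, ∫⁻ x, ‖x‖ₑ ^ 2 ∂(intensity P (μ k)) < ∞)
    (hLp : ∀ k, MemLp (fun ω => dist (μ k ω) (ν ω)) 2 P)
    (h : Tendsto (fun k => eLpNorm (fun ω => dist (μ k ω) (ν ω)) 2 P) atTop (𝓝 0)) :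
    IsCompact (closure (Set.range fun k => intensityPoint P (μ k) (hμ k) (hI k))) := by
  have hsq : ∀ m : Measure E, ∫⁻ x, ‖x‖ₑ ^ 2 ∂m = eLpNorm norm 2 m ^ 2 := fun m => by
    simp only [sq_eLpNorm_two, enorm_norm]
  have hIν : ∫⁻ x, ‖x‖ₑ ^ 2 ∂(intensity P ν) < ∞ := by
    have hclose := lipschitzL2Close_intensity (P := P) hν (hμ 0) _ lipschitzWith_one_norm
    simp only [dist_comm (ν _)] at hclose
    rw [hsq]
    refine ENNReal.pow_lt_top (hclose.trans_lt (ENNReal.add_lt_top.2 ⟨?_, (hLp 0).eLpNorm_lt_top⟩))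
    simpa [hsq] using hI 0
  obtain ⟨ht, hU⟩ := WassersteinSpace.isTightMeasureSet_and_unifSqIntegrable_of_finite_net
    (A := WassersteinSpace.toMeasure ''
      (Set.range fun k => intensityPoint P (μ k) (hμ k) (hI k))) fun ε hε => by
    obtain ⟨k₀, hk₀⟩ := (h.eventually (ge_mem_nhds (pos_iff_ne_zero.2 hε))).exists_forall_of_atTop
    refine ⟨insert (intensityPoint P ν hν hIν)
      ((fun k => intensityPoint P (μ k) (hμ k) (hI k)) '' Set.Iio k₀),
      ((Set.finite_Iio k₀).image _).insert _, ?_⟩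
    rintro _ ⟨_, ⟨k, rfl⟩, rfl⟩
    rcases lt_or_ge k k₀ with hk | hk
    · exact ⟨_, Set.mem_insert_of_mem _ ⟨k, hk, rfl⟩, .refl _ _⟩
    · exact ⟨_, Set.mem_insert _ _, (lipschitzL2Close_intensity (hμ k) hν).mono (hk₀ k hk)⟩
  exact WassersteinSpace.isCompact_closure_of_isTightMeasureSet ht hU

theorem exists_tendsto_intensityPoint_of_map_eq {Ω' : Type*} [MeasurableSpace Ω']
    {P' : Measure Ω'} [IsProbabilityMeasure P'] {μ : ℕ → Ω → WassersteinSpace E}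
    {μ' : ℕ → Ω' → WassersteinSpace E} {ν : Ω' → WassersteinSpace E} (hμ : ∀ k, Measurable (μ k))
    (hI : ∀ k, ∫⁻ x, ‖x‖ₑ ^ 2 ∂(intensity P (μ k)) < ∞) (hμ' : ∀ k, Measurable (μ' k))
    (hν : Measurable ν) (hmap : ∀ k, P'.map (μ' k) = P.map (μ k))
    (hLp : ∀ k, MemLp (fun ω => dist (μ' k ω) (ν ω)) 2 P')
    (h : Tendsto (fun k => eLpNorm (fun ω => dist (μ' k ω) (ν ω)) 2 P') atTop (𝓝 0)) :
    ∃ (a : WassersteinSpace E) (θ : ℕ → ℕ), StrictMono θ ∧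
      Tendsto (fun k => intensityPoint P (μ (θ k)) (hμ _) (hI _)) atTop (𝓝 a) := by
  have hint : ∀ k, intensity P' (μ' k) = intensity P (μ k) := fun k => by
    rw [intensity_eq_bind_map (hμ k), intensity_eq_bind_map (hμ' k), hmap k]
  have hI' : ∀ k, ∫⁻ x, ‖x‖ₑ ^ 2 ∂(intensity P' (μ' k)) < ∞ := fun k => hint k ▸ hI k
  obtain ⟨a, -, θ, hθ, ha⟩ := (isCompact_closure_range_intensityPoint_of_tendsto hμ' hν hI' hLp
    h).tendsto_subseq fun k => subset_closure (Set.mem_range_self k)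
  exact ⟨a, θ, hθ, ha.congr fun k => WassersteinSpace.ext (hint (θ k))⟩

end RandomMeasure

theorem mainTheorem6_general {E : Type u} [NormedAddCommGroup E]
    [CompleteSpace E] [TopologicalSpace.SeparableSpace E] [MeasurableSpace E] [BorelSpace E]
    {Ω : Type v} [MeasurableSpace Ω] (P : Measure Ω) [IsProbabilityMeasure P]
    (μ : ℕ → Ω → WassersteinSpace E) (hμ : ∀ N, Measurable (μ N))
    (hI : ∀ N, ∫⁻ x, ‖x‖ₑ ^ 2 ∂(intensity P (μ N)) < ∞) :
    List.TFAE [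
      IsCompact (closure (Set.range fun N => intensityPoint P (μ N) (hμ N) (hI N))),
      IsTightMeasureSet (Set.range fun N => intensity P (μ N)) ∧
        Tendsto (fun R : ℝ => ⨆ N, ∫⁻ x in {x : E | R < ‖x‖}, ‖x‖ₑ ^ 2 ∂(intensity P (μ N)))
          atTop (𝓝 0),
      ∀ φ : ℕ → ℕ, StrictMono φ → ∃ ψ : ℕ → ℕ, StrictMono ψ ∧
        ∃ (Ω' : Type w) (_ : MeasurableSpace Ω') (P' : Measure Ω')
          (μ' : ℕ → Ω' → WassersteinSpace E) (μlim : Ω' → WassersteinSpace E),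
          IsProbabilityMeasure P' ∧ (∀ k, Measurable (μ' k)) ∧ Measurable μlim ∧
          (∀ k, IdentDistrib (μ' k) (μ (φ (ψ k))) P' P) ∧
          (∀ᵐ ω ∂P', Tendsto (fun k => dist (μ' k ω) (μlim ω)) atTop (𝓝 0)) ∧
          (∀ k, MemLp (fun ω => dist (μ' k ω) (μlim ω)) 2 P') ∧
          Tendsto (fun k => eLpNorm (fun ω => dist (μ' k ω) (μlim ω)) 2 P') atTop (𝓝 0)] := by
  have : SecondCountableTopology E := UniformSpace.secondCountable_of_separable E
  have hUI := unifSqIntegrable_range_iff (0 : E) (ν := fun N => intensity P (μ N))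
  simp only [dist_zero_right, edist_zero_right] at hUI
  tfae_have 1 → 2 := by
    intro h
    have hcrit := WassersteinSpace.isTightMeasureSet_and_unifSqIntegrable_of_totallyBounded
      (h.totallyBounded.subset subset_closure)
    rw [← Set.range_comp] at hcrit
    exact hcrit.imp_right hUI.1
  tfae_have 2 → 3 := by
    rintro ⟨ht, hU⟩ φ -
    have hsub : (Set.range fun N => intensity P (μ (φ N))) ⊆ Set.range fun N => intensity P (μ N) :=
      Set.range_comp_subset_range φ fun N => intensity P (μ N)
    have hUφ := (hUI.2 hU).mono hsub
    obtain ⟨ψ, hψ, Ω', mΩ', P', μ', μlim, hP', hμ', hlim, hmap, hconv⟩ :=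
      exists_skorokhod_representation
        (fun N => Measure.isProbabilityMeasure_map (hμ (φ N)).aemeasurable)
        (isTightMeasureSet_range_map (fun N => hμ (φ N)) (ht.subset hsub) hUφ)
        (unifSqIntegrable_range_map (fun N => hμ (φ N)) hUφ)
    exact ⟨ψ, hψ, Ω', mΩ', P', μ', μlim, hP', hμ', hlim,
      fun k => ⟨(hμ' k).aemeasurable, (hμ _).aemeasurable, hmap k⟩, hconv⟩
  tfae_have 3 → 1 := by
    refine fun h => isCompact_closure_range_of_subseq fun φ hφ => ?_
    obtain ⟨ψ, hψ, Ω', mΩ', P', μ', μlim, hP', hμ', hlim, hid, -, hLp, hto⟩ := h φ hφ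
    obtain ⟨a, θ, hθ, ha⟩ := exists_tendsto_intensityPoint_of_map_eq (fun k => hμ (φ (ψ k)))
      (fun k => hI _) hμ' hlim (fun k => (hid k).map_eq) hLp hto
    exact ⟨a, ψ ∘ θ, hψ.comp hθ, ha⟩
  tfae_finish

theorem mainTheorem6 {E : Type u} [NormedAddCommGroup E] [NormedSpace ℝ E]
    [CompleteSpace E] [TopologicalSpace.SeparableSpace E] [MeasurableSpace E] [BorelSpace E]
    {Ω : Type v} [MeasurableSpace Ω] (P : Measure Ω) [IsProbabilityMeasure P]
    (μ : ℕ → Ω → WassersteinSpace E) (hμ : ∀ N, Measurable (μ N))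
    (hI : ∀ N, ∫⁻ x, ‖x‖ₑ ^ 2 ∂(intensity P (μ N)) < ∞) :
    List.TFAE [
      -- (i) the intensities form a relatively compact subset of `𝒫₂(E)`
      IsCompact (closure (Set.range fun N => intensityPoint P (μ N) (hμ N) (hI N))),
      -- (ii) the intensities are tight, with uniformly integrable second moments
      IsTightMeasureSet (Set.range fun N => intensity P (μ N)) ∧
        Tendsto (fun R : ℝ => ⨆ N, ∫⁻ x in {x : E | R < ‖x‖}, ‖x‖ₑ ^ 2 ∂(intensity P (μ N)))
          atTop (𝓝 0),
      -- (iii) every subsequence has a further subsequence with a Skorokhod representation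
      ∀ φ : ℕ → ℕ, StrictMono φ → ∃ ψ : ℕ → ℕ, StrictMono ψ ∧
        ∃ (Ω' : Type w) (_ : MeasurableSpace Ω') (P' : Measure Ω')
          (μ' : ℕ → Ω' → WassersteinSpace E) (μlim : Ω' → WassersteinSpace E),
          IsProbabilityMeasure P' ∧ (∀ k, Measurable (μ' k)) ∧ Measurable μlim ∧
          (∀ k, IdentDistrib (μ' k) (μ (φ (ψ k))) P' P) ∧
          (∀ᵐ ω ∂P', Tendsto (fun k => dist (μ' k ω) (μlim ω)) atTop (𝓝 0)) ∧
          (∀ k, MemLp (fun ω => dist (μ' k ω) (μlim ω)) 2 P') ∧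
          Tendsto (fun k => eLpNorm (fun ω => dist (μ' k ω) (μlim ω)) 2 P') atTop (𝓝 0)] :=
  mainTheorem6_general P μ hμ hI
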